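/- All graphs are finite and simple. Let $s,t\ge 1$, and let $N(K_{s,t},G)$ denote the number of (not necessarily induced) subgraphs of $G$ isomorphic to the complete bipartite graph $K_{s,t}$. For integers $n\ge k\ge 4$ and $1\le a<k/2$ put $$g_{s,t}(n,k,a)=\begin{cases}\displaystyle\sum_{i=1}^{n-k+a}\binom{a}{s}\binom{n-s-i}{s-1}+\frac12\binom{k-a}{2s}\binom{2s}{s}, & s=t,\\[2mm] \displaystyle\sum_{i=1}^{n-k+a}\left(\binom{a}{s}\binom{n-s-i}{t-1}+\binom{a}{t}\binom{n-t-i}{s-1}\right)+\binom{k-a}{s+t}\binom{s+t}{s}, & s\ne t,\end{cases}$$ where $\binom mj=0$ if $m<j$. (If $a\ge k/2$, the same formula is used with the differences $k-a$, $n-s-i$, $n-t-i$ replaced by $0$ when they are negative.) Let $H_{n,k,a}$, for $1\le a<k/2$, be the $n$-vertex graph whose vertex set is partitioned into $A,B,C$ with $|A|=a$, $|B|=n-k+a$, $|C|=k-2a$, and whose edges are all pairs inside $A\cup C$ and all pairs between $A$ and $B$. Let $n\ge k\ge 5$, $r\ge 2$ and $h=\lfloor (k-1)/2\rfloor$. (1)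 If $G$ is a 2-connected graph on $n$ vertices with minimum degree $\delta(G)\ge r$ and $$N(K_{s,t},G)>\max\{g_{s,t}(n,k,r),\,g_{s,t}(n,k,h)\},$$ then $G$ contains a cycle of length at least $k$. (2) The bound is sharp: if $r<k/2$, then for each $a\in\{r,h\}$ the graph $H_{n,k,a}$ is 2-connected, has minimum degree at least $r$, contains no cycle of length at least $k$, and satisfies $N(K_{s,t},H_{n,k,a})=g_{s,t}(n,k,a)$. -/

import Mathlib

namespace LongCycle

/-- A finite graph is 2-connected: it has at least three vertices, it is connected, and it stays
connected after the deletion of any one vertex. -/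
def TwoConnected {V : Type*} [Fintype V] (G : SimpleGraph V) : Prop :=
  3 ≤ Fintype.card V ∧ G.Connected ∧ ∀ v : V, (G.induce ({v}ᶜ : Set V)).Connected

/-- `G` contains a cycle of length at least `k`. -/
def HasCycleOfLengthAtLeast {V : Type*} (G : SimpleGraph V) (k : ℕ) : Prop :=
  ∃ (v : V) (p : G.Walk v v), p.IsCycle ∧ k ≤ p.length

/-- `N(K_{s,t}, G)`: the number of subgraphs of `G` (not necessarily induced) that are isomorphic
to the complete bipartite graph `K_{s,t}`. -/
noncomputable def numK {V : Type*} [Fintype V] (s t : ℕ) (G : SimpleGraph V) : ℕ :=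
  G.copyCount (completeBipartiteGraph (Fin s) (Fin t))

/-- The function `g_{s,t}(n,k,a)`. For `n ≥ k`, `2 * a < k` and `s, t ≥ 1` no subtraction that
affects the value is truncated, and the division by two is exact since `(2 * s).choose s` is
even. -/
def g (s t n k a : ℕ) : ℕ :=
  if s = t then
    (∑ i ∈ Finset.Icc 1 (n - k + a), a.choose s * (n - s - i).choose (s - 1))
      + (k - a).choose (2 * s) * (2 * s).choose s / 2
  else
    (∑ i ∈ Finset.Icc 1 (n - k + a),
      (a.choose s * (n - s - i).choose (t - 1) + a.choose t * (n - t - i).choose (s - 1)))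
      + (k - a).choose (s + t) * (s + t).choose s

/-- The graph `H_{n,k,a}` (for `n ≥ k > 2 * a`) on the vertices `0, …, n - 1`, with the partition
`A = {0, …, a - 1}`, `C = {a, …, k - a - 1}`, `B = {k - a, …, n - 1}`, so that `|A| = a`,
`|C| = k - 2 * a`, `|B| = n - k + a`. Its edges are all pairs inside `A ∪ C` and all pairs between
`A` and `B`. -/
def H (n k a : ℕ) : SimpleGraph (Fin n) where
  Adj i j := i ≠ j ∧
    (((i : ℕ) < k - a ∧ (j : ℕ) < k - a) ∨
      ((i : ℕ) < a ∧ k - a ≤ (j : ℕ)) ∨ ((j : ℕ) < a ∧ k - a ≤ (i : ℕ)))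
  symm := ⟨fun i j h => ⟨h.1.symm, by have := h.2; tauto⟩⟩
  loopless := ⟨fun _ h => h.1 rfl⟩

instance (n k a : ℕ) : DecidableRel (H n k a).Adj := fun i j =>
  inferInstanceAs (Decidable (i ≠ j ∧
    (((i : ℕ) < k - a ∧ (j : ℕ) < k - a) ∨
      ((i : ℕ) < a ∧ k - a ≤ (j : ℕ)) ∨ ((j : ℕ) < a ∧ k - a ≤ (i : ℕ)))))

/-- `H_{n,k,a}` is an extremal graph: it is 2-connected, its minimum degree is at least `r`, it has
no cycle of length at least `k`, and it has exactly `g_{s,t}(n,k,a)` copies of `K_{s,t}`. -/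
def IsSharp (s t n k r a : ℕ) : Prop :=
  TwoConnected (H n k a) ∧ r ≤ (H n k a).minDegree ∧
    ¬ HasCycleOfLengthAtLeast (H n k a) k ∧ numK s t (H n k a) = g s t n k a

end LongCycle

/-! Part (1) is Kopylov's disintegration argument. Suppose there is no cycle of length at least `k`,
and add edges as long as none appears; 2-connectedness and the degree bound survive and no copy of
`K_{s,t}` is lost. Now any two nonadjacent vertices are the ends of a path on at least `k` vertices.
Pósa's lemma (`IsPathSeq.hasCycle`) says that the ends of such a path have fewer than `k` neighbours
on it in total. Applied to a longest suitable path, this gives `adj_of_degree`: vertex sets inducing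
minimum degrees with sum at least `k` are completely joined.

Put `h = (k - 1) / 2` and delete vertices of degree at most `h` as long as possible. If nothing
remains, adding up the bicliques lost at each deletion, until `k - h` vertices are left, gives the
bound with parameter `h`. Otherwise the remainder is a clique on `l < k` vertices. With `a = k - l`,
the joining property gives `r ≤ a ≤ h` and shows that deleting vertices of degree at most `a` stops
at the same clique; this gives the bound with parameter `a`. The bound is convex in `a`
(`orderedG_convex`), so its value is at most the larger of those at `r` and `h`.

All counting is done with ordered pairs of parts, which count each copy once if `s ≠ t` and twice if
`s = t` (`numK_mul`).

For part (2), the neighbours of a vertex of `B` are adjacent to everything, so every deletion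
estimate is an equality. A cycle of length at least `k` would have at least `a` vertices in `B`,
whose successors use up all of `A`; then it could never leave `C`. -/

namespace LongCycle

/-! ### Paths, separation and disjoint linkages -/

section Paths

variable {V : Type*} [DecidableEq V] {G : SimpleGraph V}

/-- `PathOn G a b S`: the graph `G` has a path from `a` to `b` whose vertex set is `S`. -/
inductive PathOn (G : SimpleGraph V) : V → V → Finset V → Prop
  | single (a : V) : PathOn G a a {a}
  | cons {a b c : V} {S : Finset V} (hab : G.Adj a b) (ha : a ∉ S) (h : PathOn G b c S) :
      PathOn G a c (insert a S)

namespace PathOn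

lemma left_mem {a b : V} {S : Finset V} (h : PathOn G a b S) : a ∈ S := by
  cases h <;> simp

lemma right_mem {a b : V} {S : Finset V} (h : PathOn G a b S) : b ∈ S := by
  induction h with
  | single => simp
  | cons _ _ _ ih => simp [ih]

lemma join {a b c : V} {S T : Finset V} (h₁ : PathOn G a b S) (h₂ : PathOn G b c T)
    (h : ∀ v ∈ S, v ∈ T → v = b) : PathOn G a c (S ∪ T) := by
  induction h₁ with
  | single a =>
    have := h₂.left_mem
    rwa [Finset.singleton_union, Finset.insert_eq_of_mem this]
  | @cons a b' c' S hab ha h₁ ih =>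
    rw [Finset.insert_union]
    refine cons hab ?_ (ih h₂ fun v hv => h v (by simp [hv]))
    have := h₁.right_mem
    have := h a (by simp)
    grind

lemma reverse {a b : V} {S : Finset V} (h : PathOn G a b S) : PathOn G b a S := by
  induction h with
  | single a => exact single a
  | @cons a b c S hab ha h ih =>
    have h₂ : PathOn G b a {b, a} := cons hab.symm (by simpa using hab.ne') (single a)
    have h₃ := ih.join h₂ (by grind)
    have hb := h.left_mem
    rwa [show S ∪ {b, a} = insert a S by grind] at h₃

lemma split {a b w : V} {S : Finset V} (h : PathOn G a b S) (hw : w ∈ S) :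
    ∃ S₁ S₂, PathOn G a w S₁ ∧ PathOn G w b S₂ ∧ S₁ ∪ S₂ = S ∧ ∀ v ∈ S₁, v ∈ S₂ → v = w := by
  induction h with
  | single a =>
    obtain rfl : w = a := by simpa using hw
    exact ⟨{w}, {w}, single w, single w, by simp, by simp⟩
  | @cons a b c S hab ha h ih =>
    by_cases hwa : w = a
    · subst hwa
      exact ⟨{w}, insert w S, single w, cons hab ha h, by grind, by simp⟩
    · obtain ⟨S₁, S₂, h₁, h₂, hS, hd⟩ := ih (by grind)
      exact ⟨insert a S₁, S₂, cons hab (by grind) h₁, h₂, by grind, by grind⟩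

lemma bridge {a b c d : V} {S T : Finset V} (h₁ : PathOn G a b S) (hbc : G.Adj b c)
    (h₂ : PathOn G c d T) (h : Disjoint S T) : PathOn G a d (S ∪ T) := by
  have hb := h₁.right_mem
  have hbT : b ∉ T := Finset.disjoint_left.mp h hb
  have := h₁.join (cons hbc hbT h₂) (by
    intro v hv hv'
    have := Finset.disjoint_left.mp h hv
    grind)
  rwa [show S ∪ insert b T = S ∪ T by grind] at this

lemma of_walk {a b : V} (p : G.Walk a b) (hp : p.IsPath) : PathOn G a b p.support.toFinset := by
  induction p with
  | nil => simpa using single _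
  | cons h p ih =>
    rw [SimpleGraph.Walk.cons_isPath_iff] at hp
    rw [SimpleGraph.Walk.support_cons, List.toFinset_cons]
    exact cons h (by simpa using hp.2) (ih hp.1)

lemma exists_walk {a b : V} {S : Finset V} (h : PathOn G a b S) :
    ∃ p : G.Walk a b, p.IsPath ∧ p.support.toFinset = S := by
  induction h with
  | single a => exact ⟨.nil, by simp, by simp⟩
  | cons hab ha h ih =>
    obtain ⟨p, hp, rfl⟩ := ih
    exact ⟨.cons hab p, by simpa [SimpleGraph.Walk.cons_isPath_iff] using ⟨hp, by simpa using ha⟩,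
      by simp⟩

/-- An indexing of the vertices of a path. -/
lemma exists_index {a b : V} {S : Finset V} (h : PathOn G a b S) :
    ∃ x : ℕ → V, x 0 = a ∧ x (S.card - 1) = b ∧
      (∀ i j, i < S.card → j < S.card → x i = x j → i = j) ∧
      (∀ i, i + 1 < S.card → G.Adj (x i) (x (i + 1))) ∧ (∀ v ∈ S, ∃ i < S.card, x i = v) ∧
      ∀ i < S.card, x i ∈ S := by
  induction h with
  | single a => exact ⟨fun _ => a, by simp⟩
  | @cons a b c S hab ha h ih =>
    obtain ⟨x, h0, h1, hinj, hadj, hsurj, hmem⟩ := ih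
    have hpos : 0 < S.card := Finset.card_pos.mpr ⟨_, h.left_mem⟩
    rw [Finset.card_insert_of_notMem ha]
    refine ⟨fun i => if i = 0 then a else x (i - 1), by simp, ?_, ?_, ?_, ?_, ?_⟩
    · simp [hpos.ne', h1]
    · intro i j hi hj hij
      have := hinj (i - 1) (j - 1)
      have := hmem (i - 1)
      have := hmem (j - 1)
      grind
    · intro i hi
      rcases i with _ | i
      · simpa [h0] using hab
      · simpa using hadj i (by omega)
    · intro v hv
      rcases Finset.mem_insert.mp hv with rfl | hv
      · exact ⟨0, by simp⟩
      · obtain ⟨i, hi, rfl⟩ := hsurj v hv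
        exact ⟨i + 1, by omega, by simp⟩
    · intro i hi
      have := hmem (i - 1)
      grind

end PathOn

lemma HasCycleOfLengthAtLeast.mono {V : Type*} {G : SimpleGraph V} {k l : ℕ}
    (h : HasCycleOfLengthAtLeast G l) (hkl : k ≤ l) : HasCycleOfLengthAtLeast G k := by
  obtain ⟨v, p, hp, hl⟩ := h
  exact ⟨v, p, hp, hkl.trans hl⟩

/-- Closing a path with an edge gives a cycle. -/
lemma PathOn.hasCycle {a b : V} {S : Finset V} (h : PathOn G a b S) (hab : G.Adj b a)
    (hS : 3 ≤ S.card) : HasCycleOfLengthAtLeast G S.card := by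
  obtain ⟨p, hp, rfl⟩ := h.exists_walk
  rw [List.toFinset_card_of_nodup hp.support_nodup, SimpleGraph.Walk.length_support] at *
  refine ⟨b, .cons hab p, ?_, by simp⟩
  rw [SimpleGraph.Walk.cons_isCycle_iff]
  refine ⟨hp, fun he => ?_⟩
  -- The closing edge can only repeat an edge of the path if the path is that single edge.
  have h1 : p.length = 1 := by
    cases p with
    | nil => simp at hS
    | @cons _ c _ hac q =>
      have hq := (SimpleGraph.Walk.cons_isPath_iff _ _).mp hp
      rw [SimpleGraph.Walk.edges_cons, List.mem_cons] at he
      rcases he with he | he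
      · have : b = c := by
          simp only [Sym2.eq_iff] at he
          grind
        subst this
        have := (SimpleGraph.Walk.isPath_iff_nil.mp hq.1).eq_nil
        simp [this]
      · exact absurd (q.snd_mem_support_of_mem_edges he) hq.2
  omega

/-- Two internally disjoint paths with the same ends form a cycle. -/
lemma PathOn.hasCycle_union {a b : V} {S T : Finset V} (h₁ : PathOn G a b S) (h₂ : PathOn G a b T)
    (hab : a ≠ b) (h : ∀ v ∈ S, v ∈ T → v = a ∨ v = b) (hc : 3 ≤ (S ∪ T).card) :
    HasCycleOfLengthAtLeast G (S ∪ T).card := by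
  cases h₂ with
  | single => exact absurd rfl hab
  | @cons _ c _ T hac ha h₂ =>
    have h₃ := h₂.join h₁.reverse (by grind)
    have : T ∪ S = S ∪ insert a T := by
      have := h₁.left_mem
      grind
    rw [this] at h₃
    exact h₃.hasCycle hac hc

/-- No vertex separates two others. -/
def Unseparable (G : SimpleGraph V) : Prop :=
  ∀ v a b : V, a ≠ v → b ≠ v → ∃ S, PathOn G a b S ∧ v ∉ S

lemma TwoConnected.unseparable [Fintype V] (h : TwoConnected G) : Unseparable G := by
  intro v a b ha hb
  obtain ⟨p, hp⟩ := ((h.2.2 v).preconnected ⟨a, ha⟩ ⟨b, hb⟩).exists_isPath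
  refine ⟨_, .of_walk (p.map (SimpleGraph.Embedding.induce ({v}ᶜ : Set V)).toHom)
    (hp.map (SimpleGraph.Embedding.induce (G := G) ({v}ᶜ : Set V)).injective), ?_⟩
  rw [List.mem_toFinset, SimpleGraph.Walk.support_map, List.mem_map]
  rintro ⟨⟨u, hu⟩, -, h⟩
  exact hu h

/-- A path from `X` to `Y` that avoids `v` and meets `X` and `Y` only in its ends. -/
lemma Unseparable.exists_pathOn (hG : Unseparable G) {X Y : Finset V} {v x y : V}
    (hx : x ∈ X) (hxv : x ≠ v) (hy : y ∈ Y) (hyv : y ≠ v) :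
    ∃ a ∈ X, ∃ b ∈ Y, ∃ S, PathOn G a b S ∧ v ∉ S ∧ (∀ u ∈ S, u ∈ X → u = a) ∧
      ∀ u ∈ S, u ∈ Y → u = b := by
  classical
  have hex : ∃ n, ∃ a ∈ X, ∃ b ∈ Y, ∃ S, PathOn G a b S ∧ v ∉ S ∧ S.card = n := by
    obtain ⟨S, hS, hv⟩ := hG v x y hxv hyv
    exact ⟨_, x, hx, y, hy, S, hS, hv, rfl⟩
  -- In a path with fewest vertices, a second vertex in `X` or `Y` would allow a shortcut by a
  -- subpath.
  obtain ⟨a, ha, b, hb, S, hS, hv, hn⟩ := Nat.find_spec hex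
  have hmin : ∀ a' ∈ X, ∀ b' ∈ Y, ∀ S', PathOn G a' b' S' → v ∉ S' → ¬ S' ⊂ S := by
    intro a' ha' b' hb' S' hS' hv' hlt
    have := Finset.card_lt_card hlt
    exact Nat.find_min hex (hn ▸ this) ⟨a', ha', b', hb', S', hS', hv', rfl⟩
  refine ⟨a, ha, b, hb, S, hS, hv, fun u hu huX => ?_, fun u hu huY => ?_⟩
  · by_contra hne
    obtain ⟨S₁, S₂, h₁, h₂, rfl, hd⟩ := hS.split hu
    refine hmin u huX b hb S₂ h₂ (by grind) ?_
    rw [Finset.ssubset_iff_subset_ne]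
    refine ⟨Finset.subset_union_right, fun h => hne ?_⟩
    have := h₁.left_mem
    exact (hd a this (h ▸ Finset.mem_union_left _ this)).symm
  · by_contra hne
    obtain ⟨S₁, S₂, h₁, h₂, rfl, hd⟩ := hS.split hu
    refine hmin a ha u huY S₁ h₁ (by grind) ?_
    rw [Finset.ssubset_iff_subset_ne]
    refine ⟨Finset.subset_union_left, fun h => hne ?_⟩
    have := h₂.right_mem
    exact (hd b (h ▸ Finset.mem_union_right _ this) this).symm

/-- A path `Q` from `p ∈ X` to `q ∈ Y` can be replaced by two disjoint paths between `X` and `Y`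
that still use the ends `p` and `q`. -/
lemma Unseparable.linking (hG : Unseparable G) {X Y Q : Finset V} {p q x y : V}
    (hQ : PathOn G p q Q) (hp : p ∈ X) (hq : q ∈ Y) (hQX : ∀ v ∈ Q, v ∈ X → v = p)
    (hQY : ∀ v ∈ Q, v ∈ Y → v = q) (hx : x ∈ X) (hxp : x ≠ p) (hy : y ∈ Y) (hyq : y ≠ q) :
    ∃ a ∈ X, ∃ e₁ ∈ Y, ∃ e₂ ∈ Y, ∃ S₁ S₂, PathOn G p e₁ S₁ ∧ PathOn G a e₂ S₂ ∧
      (e₁ = q ∨ e₂ = q) ∧ (∀ v ∈ S₁, v ∉ S₂) ∧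
      (∀ v ∈ S₁, v ∈ X → v = p) ∧ (∀ v ∈ S₂, v ∈ X → v = a) ∧
      (∀ v ∈ S₁, v ∈ Y → v = e₁) ∧ (∀ v ∈ S₂, v ∈ Y → v = e₂) := by
  induction hQ generalizing X x with
  | single p =>
    obtain ⟨a, ha, b, hb, S, hS, hpS, hSX, hSY⟩ := hG.exists_pathOn hx hxp hy hyq
    exact ⟨a, ha, p, hq, b, hb, {p}, S, .single p, hS, .inl rfl, by simpa using hpS, by simp, hSX,
      by simp, hSY⟩
  | @cons p b q T hpb hpT hT ih =>
    have hbT := hT.left_mem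
    have hqT := hT.right_mem
    have hbX : b ∉ X := fun h => hpT (hQX b (by simp [hbT]) h ▸ hbT)
    have hpY : p ∉ Y := fun h => hpT (hQY p (by simp) h ▸ hqT)
    have hqp : q ≠ p := fun h => hpT (h ▸ hqT)
    -- The tail of `Q` starts at `b`, so `b` joins `X` for the induction. The first path found
    -- starts at `b` and is extended back to `p`.
    obtain ⟨a, ha, e₁, he₁, e₂, he₂, S₁, S₂, h₁, h₂, he, hd, h1X, h2X, h1Y, h2Y⟩ :=
      ih (X := insert b X) (x := p) (by simp) hq (by grind) (by grind) (by simp [hp]) hpb.ne hyq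
    have hb1 := h₁.left_mem
    have ha2 := h₂.left_mem
    have haX : a ∈ X := by grind
    have hp1 : p ∉ S₁ := fun h => hpb.ne (h1X p h (by simp [hp]))
    have hp₁ : PathOn G p e₁ (insert p S₁) := .cons hpb hp1 h₁
    clear ih
    -- The only conflict is that the second path starts at `p` too. A fresh path `T'` from `X` that
    -- avoids `p` then runs to its first contact `z` with `Y` or either path.
    by_cases hap : a = p
    · subst hap
      obtain ⟨a', ha', z, hz, T', hT', hpT', hT'X, hT'Y⟩ :=
        hG.exists_pathOn (X := X.erase a) (Y := (Y ∪ S₁ ∪ S₂).erase a) (v := a) (x := x) (y := q)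
          (by grind) hxp (by grind) hqp
      have hzT' := hT'.right_mem
      have hT'1 : ∀ u ∈ T', u ∈ S₁ → u = z := fun u hu h => hT'Y u hu (by grind)
      have hT'2 : ∀ u ∈ T', u ∈ S₂ → u = z := fun u hu h => hT'Y u hu (by grind)
      have hT'3 : ∀ u ∈ T', u ∈ Y → u = z := fun u hu h => hT'Y u hu (by grind)
      have hT'4 : ∀ u ∈ T', u ∈ X → u = a' := fun u hu h => hT'X u hu (by grind)
      have h1X' : ∀ u ∈ S₁, u ∉ X := fun u hu h => hbX (h1X u hu (by grind) ▸ h)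
      have h2X' : ∀ u ∈ S₂, u ∈ X → u = a := fun u hu h => h2X u hu (by grind)
      have ha'X : a' ∈ X := Finset.mem_of_mem_erase ha'
      have hz' : z ∈ Y ∨ z ∈ S₁ ∨ z ∈ S₂ := by grind
      have hza : z ≠ a := Finset.ne_of_mem_erase hz
      clear hG hT hT'X hT'Y h1X h2X hQX hQY ha' hz
      -- If `z` is on one of the two paths, `T'` takes over the tail of that path from `z`, and the
      -- other path serves `p`. The set of ends is unchanged.
      by_cases hz1 : z ∈ S₁
      · obtain ⟨A, B, hA, hB, rfl, hAB⟩ := h₁.split hz1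
        have hBA : ∀ v ∈ B, v ∈ A ∪ B := fun v hv => Finset.mem_union_right _ hv
        refine ⟨a', ha'X, e₂, he₂, e₁, he₁, S₂, T' ∪ B, h₂,
          hT'.join hB fun v hv hv' => hT'1 v hv (hBA v hv'), he.symm, ?_, h2X', ?_, h2Y, ?_⟩ <;>
        · clear h₁ hp₁ hT' hA hB he hAB h₂
          simp only [Finset.mem_union (s := T') (t := B)]
          grind
      by_cases hz2 : z ∈ S₂
      · obtain ⟨A, B, hA, hB, rfl, hAB⟩ := h₂.split hz2
        have haA := hA.left_mem
        have haB : a ∉ B := fun h => hza (hAB a haA h).symm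
        have hBA : ∀ v ∈ B, v ∈ A ∪ B := fun v hv => Finset.mem_union_right _ hv
        refine ⟨a', ha'X, e₁, he₁, e₂, he₂, insert a S₁, T' ∪ B, hp₁,
          hT'.join hB fun v hv hv' => hT'2 v hv (hBA v hv'), he, ?_, ?_, ?_, ?_, ?_⟩ <;>
        · clear h₁ hp₁ hT' hA hB he hAB h₂
          try simp only [Finset.mem_union (s := T') (t := B)]
          grind
      have hzY : z ∈ Y := by grind
      -- If `T'` reaches `Y` away from both paths, the path ending at `q` is kept for `p`, and `T'`
      -- is the other one.
      rcases he with he | he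
      · refine ⟨a', ha'X, e₁, he₁, z, hzY, insert a S₁, T', hp₁, hT', .inl he, ?_, ?_, hT'4, ?_,
          hT'3⟩ <;> grind
      · exact ⟨a', ha'X, e₂, he₂, z, hzY, S₂, T', h₂, hT', .inl he, by grind, h2X', hT'4, h2Y, hT'3⟩
    · exact ⟨a, haX, e₁, he₁, e₂, he₂, insert p S₁, S₂, hp₁, h₂, he, by grind, by grind, by grind,
        by grind, by grind⟩

/-- The vertices `x 0, …, x (m - 1)` form a path in this order. -/
structure IsPathSeq (G : SimpleGraph V) (x : ℕ → V) (m : ℕ) : Prop where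
  inj : ∀ i j, i < m → j < m → x i = x j → i = j
  adj : ∀ i, i + 1 < m → G.Adj (x i) (x (i + 1))

/-! ### Pósa's lemma -/

namespace IsPathSeq

variable {x : ℕ → V} {m : ℕ}

omit [DecidableEq V] in
lemma reverse (h : IsPathSeq G x m) : IsPathSeq G (fun i => x (m - 1 - i)) m := by
  refine ⟨fun i j hi hj hij => ?_, fun i hi => ?_⟩
  · have := h.inj _ _ (by omega) (by omega) hij
    omega
  · have := (h.adj (m - 1 - (i + 1)) (by omega)).symm
    rwa [show m - 1 - (i + 1) + 1 = m - 1 - i by omega] at this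

/-- The set of the vertices with index in `[i, j]`. -/
def seg (x : ℕ → V) (i j : ℕ) : Finset V := (Finset.Icc i j).image x

lemma mem_seg {i j : ℕ} {v : V} : v ∈ seg x i j ↔ ∃ l, i ≤ l ∧ l ≤ j ∧ x l = v := by
  simp [seg, and_assoc]

lemma card_seg (h : IsPathSeq G x m) {i j : ℕ} (hj : j < m) : (seg x i j).card = j + 1 - i := by
  rw [seg, Finset.card_image_of_injOn, Nat.card_Icc]
  intro a ha b hb hab
  simp only [Finset.coe_Icc, Set.mem_Icc] at ha hb
  exact h.inj a b (by omega) (by omega) hab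

lemma disjoint_seg (h : IsPathSeq G x m) {i j i' j' : ℕ} (hj : j < i') (hj' : j' < m) :
    Disjoint (seg x i j) (seg x i' j') := by
  rw [Finset.disjoint_left]
  intro v hv hv'
  obtain ⟨l, h1, h2, rfl⟩ := mem_seg.mp hv
  obtain ⟨l', h1', h2', he⟩ := mem_seg.mp hv'
  have := h.inj _ _ (by omega) (by omega) he
  omega

lemma pathOn (h : IsPathSeq G x m) {i j : ℕ} (hij : i ≤ j) (hj : j < m) :
    PathOn G (x i) (x j) (seg x i j) := by
  induction j, hij using Nat.le_induction with
  | base => simpa [seg] using PathOn.single (G := G) (x i)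
  | succ j hij ih =>
    have h1 := (ih (by omega)).bridge (h.adj j hj) (.single _) (by
      have := h.disjoint_seg (i := i) (j := j) (i' := j + 1) (j' := j + 1) (by omega) hj
      simpa [seg] using this)
    have : seg x i j ∪ {x (j + 1)} = seg x i (j + 1) := by
      ext v
      simp only [Finset.mem_union, Finset.mem_singleton, mem_seg]
      constructor
      · rintro (⟨l, h1, h2, rfl⟩ | rfl)
        · exact ⟨l, h1, by omega, rfl⟩
        · exact ⟨j + 1, by omega, le_rfl, rfl⟩
      · rintro ⟨l, h1, h2, rfl⟩
        rcases Nat.lt_or_ge j l with h3 | h3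
        · exact .inr (by rw [show l = j + 1 by omega])
        · exact .inl ⟨l, h1, h3, rfl⟩
    rwa [this] at h1

variable [DecidableRel G.Adj]

/-- The indices of the neighbours of `v` on the path. -/
def nbr (G : SimpleGraph V) [DecidableRel G.Adj] (x : ℕ → V) (m : ℕ) (v : V) : Finset ℕ :=
  (Finset.range m).filter fun i => G.Adj v (x i)

omit [DecidableEq V] in
lemma mem_nbr {v : V} {i : ℕ} : i ∈ nbr G x m v ↔ i < m ∧ G.Adj v (x i) := by
  simp [nbr]

/-- If `x 0` is adjacent to `x p`, then for each `a < p` there is a path from `x a` to `x p` through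
`x 0` and its neighbours among `x 0, …, x p`. -/
lemma exists_pathOn_initial (h : IsPathSeq G x m) {a p : ℕ} (hap : a < p) (hp : p ∈ nbr G x m (x 0)) :
    ∃ S, PathOn G (x a) (x p) S ∧ S ⊆ seg x 0 p ∧ x 0 ∈ S ∧
      ∀ i ∈ nbr G x m (x 0), i ≤ p → x i ∈ S := by
  have hpm := (mem_nbr.mp hp).1
  have hex : ∃ l, a < l ∧ l ∈ nbr G x m (x 0) := ⟨p, hap, hp⟩
  classical
  -- With `l` the first neighbour index after `a`, the path goes from `x a` down to `x 0`, jumps to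
  -- `x l` and continues to `x p`. The skipped indices, strictly between `a` and `l`, belong to no
  -- neighbour of `x 0`.
  obtain ⟨hal, hl⟩ := Nat.find_spec hex
  have hlp : Nat.find hex ≤ p := Nat.find_min' hex ⟨hap, hp⟩
  have hmin : ∀ i, a < i → i ∈ nbr G x m (x 0) → Nat.find hex ≤ i :=
    fun i h1 h2 => Nat.find_min' hex ⟨h1, h2⟩
  generalize Nat.find hex = l at *
  have h1 := h.pathOn (Nat.zero_le a) (by omega)
  have h2 := h.pathOn hlp hpm
  refine ⟨_, h1.reverse.bridge (mem_nbr.mp hl).2 h2 (h.disjoint_seg hal hpm), ?_, ?_, ?_⟩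
  · intro v hv
    rw [Finset.mem_union, mem_seg, mem_seg] at hv
    rw [mem_seg]
    grind
  · exact Finset.mem_union_left _ (mem_seg.mpr ⟨0, le_rfl, by omega, rfl⟩)
  · intro i hi hip
    rw [Finset.mem_union, mem_seg, mem_seg]
    by_cases hia : i ≤ a
    · exact .inl ⟨i, by omega, hia, rfl⟩
    · exact .inr ⟨i, hmin i (by omega) hi, hip, rfl⟩

/-- The ends of the path have crossing neighbours. -/
lemma hasCycle_of_crossing (h : IsPathSeq G x m) {k i j : ℕ} (hk : 3 ≤ k) (hkm : k ≤ m) (hij : i < j)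
    (hj : j ∈ nbr G x m (x 0)) (hi : i ∈ nbr G x m (x (m - 1)))
    (hdeg : k ≤ (nbr G x m (x 0)).card + (nbr G x m (x (m - 1))).card) :
    HasCycleOfLengthAtLeast G k := by
  classical
  -- A crossing pair at minimal distance `d` is chosen. The cycle `x 0, …, x i, x (m - 1), …, x j`
  -- omits only the `d - 1` vertices between `x i` and `x j`.
  have hex : ∃ d, ∃ i j, i + d = j ∧ 0 < d ∧ j ∈ nbr G x m (x 0) ∧ i ∈ nbr G x m (x (m - 1)) :=
    ⟨j - i, i, j, by omega, by omega, hj, hi⟩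
  clear hij hj hi i j
  obtain ⟨i, j, hij, hd, hj, hi⟩ := Nat.find_spec hex
  have hmin : ∀ i' j', i' < j' → j' ∈ nbr G x m (x 0) → i' ∈ nbr G x m (x (m - 1)) →
      Nat.find hex ≤ j' - i' :=
    fun i' j' h1 h2 h3 => Nat.find_min' hex ⟨i', j', by omega, by omega, h2, h3⟩
  generalize Nat.find hex = d at *
  have hjm := (mem_nbr.mp hj).1
  have h1 := h.pathOn (Nat.zero_le i) (by omega)
  have h2 := (h.pathOn (i := j) (j := m - 1) (by omega) (by omega)).reverse
  have hdisj := h.disjoint_seg (i := 0) (j := i) (i' := j) (j' := m - 1) (by omega) (by omega)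
  have h3 := h1.bridge (mem_nbr.mp hi).2.symm h2 hdisj
  have hcard : (seg x 0 i ∪ seg x j (m - 1)).card = i + 1 + (m - j) := by
    rw [Finset.card_union_of_disjoint hdisj, h.card_seg (by omega), h.card_seg (by omega)]
    omega
  suffices hle : k ≤ (seg x 0 i ∪ seg x j (m - 1)).card from
    (h3.hasCycle (mem_nbr.mp hj).2.symm (hk.trans hle)).mono hle
  rw [hcard]
  by_cases hd1 : d = 1
  · omega
  refine hdeg.trans ?_
  have hpos : ∀ l ∈ nbr G x m (x 0), 0 < l := by
    intro l hl
    rcases Nat.eq_zero_or_pos l with rfl | h0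
    · exact absurd (mem_nbr.mp hl).2 (G.irrefl)
    · exact h0
  have hlast : ∀ l ∈ nbr G x m (x (m - 1)), l ≠ m - 1 := by
    rintro l hl rfl
    exact G.irrefl (mem_nbr.mp hl).2
  -- For `d > 1` the neighbour indices of `x 0`, shifted down by one, are disjoint from those of `x
  -- (m - 1)`. By minimality both sets avoid the gap, and the indices left to them are exactly as
  -- many as the vertices of the cycle.
  have hshift : ((nbr G x m (x 0)).image (· - 1)).card = (nbr G x m (x 0)).card := by
    refine Finset.card_image_of_injOn fun a ha b hb hab => ?_
    have := hpos a ha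
    have := hpos b hb
    have hab : a - 1 = b - 1 := hab
    omega
  rw [← hshift, ← Finset.card_union_of_disjoint]
  · have hsub : (nbr G x m (x 0)).image (· - 1) ∪ nbr G x m (x (m - 1)) ⊆
        Finset.Icc 0 i ∪ Finset.Icc (j - 1) (m - 2) := by
      intro l hl
      rw [Finset.mem_union, Finset.mem_Icc, Finset.mem_Icc]
      rcases Finset.mem_union.mp hl with hl | hl
      · obtain ⟨l', hl', rfl⟩ := Finset.mem_image.mp hl
        have := hpos l' hl'
        have := (mem_nbr.mp hl').1
        by_cases hil : i < l'
        · have := hmin i l' hil hl' hi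
          omega
        · omega
      · have := (mem_nbr.mp hl).1
        have := hlast l hl
        by_cases hil : l < j
        · have := hmin l j hil hj hl
          omega
        · omega
    refine (Finset.card_le_card hsub).trans ((Finset.card_union_le _ _).trans ?_)
    rw [Nat.card_Icc, Nat.card_Icc]
    omega
  · rw [Finset.disjoint_left]
    intro l hl hl'
    obtain ⟨l₀, hl₀, rfl⟩ := Finset.mem_image.mp hl
    have := hpos l₀ hl₀
    have := hmin (l₀ - 1) l₀ (by omega) hl₀ hl'
    omega

/-- The ends of the path have no crossing neighbours. -/
lemma hasCycle_of_not_crossing (hG : Unseparable G) (h : IsPathSeq G x m) {k : ℕ} (hm : 3 ≤ m)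
    (hk : 3 ≤ k)
    (hcross : ∀ j ∈ nbr G x m (x 0), ∀ i ∈ nbr G x m (x (m - 1)), j ≤ i)
    (hdeg : k ≤ (nbr G x m (x 0)).card + (nbr G x m (x (m - 1))).card) :
    HasCycleOfLengthAtLeast G k := by
  have hne1 : 1 ∈ nbr G x m (x 0) := mem_nbr.mpr ⟨by omega, h.adj 0 (by omega)⟩
  have hne2 : m - 2 ∈ nbr G x m (x (m - 1)) := by
    refine mem_nbr.mpr ⟨by omega, ?_⟩
    have := h.adj (m - 2) (by omega)
    rw [show m - 2 + 1 = m - 1 by omega] at this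
    exact this.symm
  -- The last neighbour of `x 0` and the first neighbour of `x (m - 1)` bound an initial and a final
  -- segment, which share at most the vertex `x p = x q`. Linking the segments by two disjoint paths
  -- that use `x p` and `x q` yields the cycle.
  obtain ⟨p, hp, hpmax⟩ := (nbr G x m (x 0)).exists_max_image id ⟨1, hne1⟩
  obtain ⟨q, hq, hqmin⟩ := (nbr G x m (x (m - 1))).exists_min_image id ⟨m - 2, hne2⟩
  simp only [id] at hpmax hqmin
  have hpq : p ≤ q := hcross p hp q hq
  have hp1 := hpmax 1 hne1
  have hq1 := hqmin _ hne2
  have hXY : ∀ v, v ∈ seg x 0 p → v ∈ seg x q (m - 1) → v = x p ∧ v = x q := by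
    intro v hv hv'
    obtain ⟨l, h1, h2, rfl⟩ := mem_seg.mp hv
    obtain ⟨l', h1', h2', he⟩ := mem_seg.mp hv'
    have := h.inj _ _ (by omega) (by omega) he
    subst this
    rw [show l' = p by omega, show q = p by omega]
    simp
  obtain ⟨a, ha, e₁, he₁, e₂, he₂, S₁, S₂, h₁, h₂, he, hd, h1X, h2X, h1Y, h2Y⟩ :=
    hG.linking (X := seg x 0 p) (Y := seg x q (m - 1)) (x := x 0) (y := x (m - 1))
      (h.pathOn hpq (by omega)) (mem_seg.mpr ⟨p, by omega, le_rfl, rfl⟩)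
      (mem_seg.mpr ⟨q, by omega, by omega, rfl⟩)
      (by
        intro v hv hv'
        obtain ⟨l, h1, h2, rfl⟩ := mem_seg.mp hv
        obtain ⟨l', h1', h2', he⟩ := mem_seg.mp hv'
        have := h.inj _ _ (by omega) (by omega) he
        rw [show l = p by omega])
      (by
        intro v hv hv'
        obtain ⟨l, h1, h2, rfl⟩ := mem_seg.mp hv
        obtain ⟨l', h1', h2', he⟩ := mem_seg.mp hv'
        have := h.inj _ _ (by omega) (by omega) he
        rw [show l = q by omega])
      (mem_seg.mpr ⟨0, by omega, by omega, rfl⟩)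
      (fun h0 => by have := h.inj _ _ (by omega) (by omega) h0; omega)
      (mem_seg.mpr ⟨m - 1, by omega, by omega, rfl⟩)
      (fun h0 => by have := h.inj _ _ (by omega) (by omega) h0; omega)
  have hp₁ := h₁.left_mem
  have ha₂ := h₂.left_mem
  have he₁' := h₁.right_mem
  have he₂' := h₂.right_mem
  have hapne : a ≠ x p := fun h0 => hd _ hp₁ (h0 ▸ ha₂)
  -- Inside each segment the two ends of the linkage are joined by a path that keeps all neighbours
  -- of the end of the long path.
  obtain ⟨U, hU, hUX, hU0, hUN⟩ : ∃ U, PathOn G a (x p) U ∧ U ⊆ seg x 0 p ∧ x 0 ∈ U ∧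
      ∀ i ∈ nbr G x m (x 0), x i ∈ U := by
    obtain ⟨a', h1, h2, rfl⟩ := mem_seg.mp ha
    have : a' ≠ p := fun h0 => hapne (h0 ▸ rfl)
    obtain ⟨U, hU, hUX, hU0, hUN⟩ := h.exists_pathOn_initial (a := a') (by omega) hp
    exact ⟨U, hU, hUX, hU0, fun i hi => hUN i hi (hpmax i hi)⟩
  obtain ⟨W, hW, hWY, hW0, hWN⟩ : ∃ W, PathOn G e₁ e₂ W ∧ W ⊆ seg x q (m - 1) ∧ x (m - 1) ∈ W ∧
      ∀ i ∈ nbr G x m (x (m - 1)), x i ∈ W := by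
    -- The mirror image of the initial segment, obtained from the reversed sequence.
    have key : ∀ d ∈ seg x q (m - 1), d ≠ x q → ∃ W, PathOn G d (x q) W ∧
        W ⊆ seg x q (m - 1) ∧ x (m - 1) ∈ W ∧ ∀ i ∈ nbr G x m (x (m - 1)), x i ∈ W := by
      intro d hd' hdq
      obtain ⟨d', h1, h2, rfl⟩ := mem_seg.mp hd'
      have : d' ≠ q := fun h0 => hdq (h0 ▸ rfl)
      have hmem : ∀ i ∈ nbr G x m (x (m - 1)),
          m - 1 - i ∈ nbr G (fun i => x (m - 1 - i)) m (x (m - 1 - 0)) := by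
        intro i hi
        have := (mem_nbr.mp hi).1
        rw [mem_nbr, show m - 1 - (m - 1 - i) = i by omega]
        exact ⟨by omega, (mem_nbr.mp hi).2⟩
      obtain ⟨W, hW, hWX, hW0, hWN⟩ := h.reverse.exists_pathOn_initial (a := m - 1 - d')
        (p := m - 1 - q) (by omega) (hmem q hq)
      rw [show m - 1 - (m - 1 - d') = d' by omega, show m - 1 - (m - 1 - q) = q by omega] at hW
      refine ⟨W, hW, fun v hv => ?_, hW0, fun i hi => ?_⟩
      · obtain ⟨l, h1, h2, rfl⟩ := mem_seg.mp (hWX hv)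
        exact mem_seg.mpr ⟨_, by omega, by omega, rfl⟩
      · have h5 := hWN _ (hmem i hi) (by have := hqmin i hi; omega)
        have := (mem_nbr.mp hi).1
        simp only [show m - 1 - (m - 1 - i) = i by omega] at h5
        exact h5
    have hne : e₁ ≠ e₂ := fun h0 => hd _ he₁' (h0 ▸ he₂')
    rcases he with rfl | rfl
    · obtain ⟨W, hW, h⟩ := key e₂ he₂ hne.symm
      exact ⟨W, hW.reverse, h⟩
    · exact key e₁ he₁ hne
  have hj1 := hU.join h₁ (fun v hv hv' => h1X v hv' (hUX hv))
  have hj2 := hj1.join hW (by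
    intro v hv hv'
    rcases Finset.mem_union.mp hv with hv | hv
    · have := (hXY v (hUX hv) (hWY hv')).1
      exact h1Y v (this ▸ hp₁) (hWY hv')
    · exact h1Y v hv (hWY hv'))
  have hae : a ≠ e₂ := by
    intro h0
    have := (hXY a ha (h0 ▸ he₂)).1
    exact hapne this
  have hcap : ∀ v ∈ U ∪ S₁ ∪ W, v ∈ S₂ → v = a ∨ v = e₂ := by
    intro v hv hv'
    rcases Finset.mem_union.mp hv with hv | hv
    · rcases Finset.mem_union.mp hv with hv | hv
      · exact .inl (h2X v hv' (hUX hv))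
      · exact absurd hv' (hd v hv)
    · exact .inr (h2Y v hv' (hWY hv))
  suffices hle : k ≤ (U ∪ S₁ ∪ W ∪ S₂).card from
    (hj2.hasCycle_union h₂ hae hcap (hk.trans hle)).mono hle
  have hA : ∀ v, (nbr G x m v).card = ((nbr G x m v).image x).card := by
    intro v
    refine (Finset.card_image_of_injOn fun i hi j hj hij => ?_).symm
    exact h.inj _ _ (mem_nbr.mp hi).1 (mem_nbr.mp hj).1 hij
  have hUc : (nbr G x m (x 0)).card + 1 ≤ U.card := by
    rw [hA, ← Finset.card_insert_of_notMem (a := x 0)]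
    · refine Finset.card_le_card fun v hv => ?_
      rcases Finset.mem_insert.mp hv with rfl | hv
      · exact hU0
      · obtain ⟨i, hi, rfl⟩ := Finset.mem_image.mp hv
        exact hUN i hi
    · intro h0
      obtain ⟨i, hi, h0⟩ := Finset.mem_image.mp h0
      exact G.irrefl (h0 ▸ (mem_nbr.mp hi).2)
  have hWc : (nbr G x m (x (m - 1))).card ≤ W.card := by
    rw [hA]
    refine Finset.card_le_card fun v hv => ?_
    obtain ⟨i, hi, rfl⟩ := Finset.mem_image.mp hv
    exact hWN i hi
  -- The possible common vertex `x p = x q` is paid for by counting `x 0` in `U` besides its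
  -- neighbours.
  have hUW : (U ∩ W).card ≤ 1 := by
    rw [Finset.card_le_one]
    intro v hv w hw
    rw [Finset.mem_inter] at hv hw
    rw [(hXY v (hUX hv.1) (hWY hv.2)).1, (hXY w (hUX hw.1) (hWY hw.2)).1]
  have := Finset.card_union_add_card_inter U W
  have : (U ∪ W).card ≤ (U ∪ S₁ ∪ W ∪ S₂).card := by
    refine Finset.card_le_card fun v hv => ?_
    simp only [Finset.mem_union] at hv ⊢
    tauto
  omega

/-- Pósa's lemma: a path on at least `k` vertices whose ends have at least `k` neighbours on the
path, in total, yields a cycle of length at least `k`. -/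
lemma hasCycle (hG : Unseparable G) (h : IsPathSeq G x m) {k : ℕ} (hk : 3 ≤ k) (hkm : k ≤ m)
    (hdeg : k ≤ (nbr G x m (x 0)).card + (nbr G x m (x (m - 1))).card) :
    HasCycleOfLengthAtLeast G k := by
  by_cases hcross : ∀ j ∈ nbr G x m (x 0), ∀ i ∈ nbr G x m (x (m - 1)), j ≤ i
  · exact h.hasCycle_of_not_crossing hG (hk.trans hkm) hk hcross hdeg
  · push Not at hcross
    obtain ⟨j, hj, i, hi, hij⟩ := hcross
    exact h.hasCycle_of_crossing hk hkm hij hj hi hdeg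

end IsPathSeq

/-- Pósa's lemma for a path given by its vertex set. -/
lemma PathOn.hasCycle_of_degree [Fintype V] [DecidableRel G.Adj] (hG : Unseparable G) {a b : V}
    {S A B : Finset V} {k : ℕ} (h : PathOn G a b S) (hk : 3 ≤ k) (hkS : k ≤ S.card)
    (hA : ∀ w ∈ A, w ∈ S ∧ G.Adj a w) (hB : ∀ w ∈ B, w ∈ S ∧ G.Adj b w)
    (hdeg : k ≤ A.card + B.card) : HasCycleOfLengthAtLeast G k := by
  obtain ⟨x, rfl, rfl, hinj, hadj, hsurj, -⟩ := h.exists_index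
  have key : ∀ (v : V) (C : Finset V), (∀ w ∈ C, w ∈ S ∧ G.Adj v w) →
      C.card ≤ (IsPathSeq.nbr G x S.card v).card := by
    intro v C hC
    refine (Finset.card_le_card fun w hw => ?_).trans (Finset.card_image_le (f := x))
    obtain ⟨i, hi, rfl⟩ := hsurj w (hC w hw).1
    exact Finset.mem_image_of_mem _ (IsPathSeq.mem_nbr.mpr ⟨hi, (hC _ hw).2⟩)
  have h1 := key _ A hA
  have h2 := key _ B hB
  exact (IsPathSeq.mk hinj hadj).hasCycle hG hk hkS (by omega)

end Paths

/-! ### Counting ordered bicliques by vertex deletion -/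

section Counting

variable {V : Type*} [DecidableEq V]

open Classical in
/-- The pairs `(S, T)` of sets of `s` and `t` vertices in `W` with all edges between `S` and `T`. -/
noncomputable def bicliques (G : SimpleGraph V) (s t : ℕ) (W : Finset V) :
    Finset (Finset V × Finset V) :=
  (W.powersetCard s ×ˢ W.powersetCard t).filter fun p => ∀ x ∈ p.1, ∀ y ∈ p.2, G.Adj x y

omit [DecidableEq V] in
lemma mem_bicliques {G : SimpleGraph V} {s t : ℕ} {W : Finset V} {p : Finset V × Finset V} :
    p ∈ bicliques G s t W ↔ (p.1 ⊆ W ∧ p.1.card = s) ∧ (p.2 ⊆ W ∧ p.2.card = t) ∧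
      ∀ x ∈ p.1, ∀ y ∈ p.2, G.Adj x y := by
  simp [bicliques, Finset.mem_powersetCard, and_assoc]

omit [DecidableEq V] in
lemma bicliques_mono {G G' : SimpleGraph V} (h : G ≤ G') (s t : ℕ) (W : Finset V) :
    bicliques G s t W ⊆ bicliques G' s t W := by
  intro p hp
  rw [mem_bicliques] at hp ⊢
  exact ⟨hp.1, hp.2.1, fun x hx y hy => h (hp.2.2 x hx y hy)⟩

open Classical in
/-- The common neighbours of `S` in `W`, taken `t` at a time. -/
noncomputable def completions (G : SimpleGraph V) (t : ℕ) (W S : Finset V) : Finset (Finset V) :=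
  (W.powersetCard t).filter fun T => ∀ x ∈ S, ∀ y ∈ T, G.Adj x y

omit [DecidableEq V] in
lemma mem_completions {G : SimpleGraph V} {t : ℕ} {W S T : Finset V} :
    T ∈ completions G t W S ↔ (T ⊆ W ∧ T.card = t) ∧ ∀ x ∈ S, ∀ y ∈ T, G.Adj x y := by
  simp [completions, Finset.mem_powersetCard]

/-- No vertex is adjacent to itself, so a completion of `S` is chosen from `W \ S`. If all vertices
of `N` are adjacent to the rest of `W`, every choice works and equality holds. -/
lemma sum_completions_le (G : SimpleGraph V) (s t : ℕ) {N W : Finset V} (hN : N ⊆ W) :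
    ∑ S ∈ N.powersetCard s, (completions G t W S).card ≤
      N.card.choose s * (W.card - s).choose t := by
  rw [← Finset.card_powersetCard, ← smul_eq_mul]
  refine Finset.sum_le_card_nsmul _ _ _ fun S hS => ?_
  rw [Finset.mem_powersetCard] at hS
  have hsub : completions G t W S ⊆ (W \ S).powersetCard t := by
    intro T hT
    rw [mem_completions] at hT
    rw [Finset.mem_powersetCard]
    refine ⟨fun v hv => Finset.mem_sdiff.mpr ⟨hT.1.1 hv, fun hvS => ?_⟩, hT.1.2⟩
    exact G.irrefl (hT.2 v hvS v hv)
  refine (Finset.card_le_card hsub).trans_eq ?_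
  rw [Finset.card_powersetCard, Finset.card_sdiff_of_subset (hS.1.trans hN), hS.2]

lemma sum_completions_eq {G : SimpleGraph V} (s t : ℕ) {N W : Finset V} (hN : N ⊆ W)
    (hdom : ∀ u ∈ N, ∀ w ∈ W, u ≠ w → G.Adj u w) :
    ∑ S ∈ N.powersetCard s, (completions G t W S).card =
      N.card.choose s * (W.card - s).choose t := by
  rw [← Finset.card_powersetCard, ← smul_eq_mul, ← Finset.sum_const]
  refine Finset.sum_congr rfl fun S hS => ?_
  rw [Finset.mem_powersetCard] at hS
  have heq : completions G t W S = (W \ S).powersetCard t := by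
    ext T
    rw [mem_completions, Finset.mem_powersetCard]
    refine ⟨fun hT => ⟨fun v hv => Finset.mem_sdiff.mpr ⟨hT.1.1 hv, fun hvS => ?_⟩, hT.1.2⟩,
      fun hT => ⟨⟨hT.1.trans Finset.sdiff_subset, hT.2⟩, fun x hx y hy => ?_⟩⟩
    · exact G.irrefl (hT.2 v hvS v hv)
    · have hy' := Finset.mem_sdiff.mp (hT.1 hy)
      exact hdom x (hS.1 hx) y hy'.1 fun h => hy'.2 (h ▸ hx)
  rw [heq, Finset.card_powersetCard, Finset.card_sdiff_of_subset (hS.1.trans hN), hS.2]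

omit [DecidableEq V] in
lemma card_bicliques (G : SimpleGraph V) (s t : ℕ) (W : Finset V) :
    (bicliques G s t W).card = ∑ S ∈ W.powersetCard s, (completions G t W S).card := by
  classical
  rw [← Finset.card_sigma]
  refine Finset.card_nbij' (fun p => ⟨p.1, p.2⟩) (fun p => (p.1, p.2)) ?_ ?_ ?_ ?_
  · intro p hp
    rw [Finset.mem_coe, mem_bicliques] at hp
    simpa [mem_completions, Finset.mem_powersetCard] using hp
  · rintro ⟨S, T⟩ hp
    rw [Finset.mem_coe, mem_bicliques]
    simpa [mem_completions, Finset.mem_powersetCard] using hp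
  · intro p _
    rfl
  · intro p _
    rfl

omit [DecidableEq V] in
lemma card_bicliques_swap (G : SimpleGraph V) (s t : ℕ) (W : Finset V)
    (P : Finset V → Prop) [DecidablePred P] :
    ((bicliques G s t W).filter fun p => P p.1).card =
      ((bicliques G t s W).filter fun p => P p.2).card := by
  refine Finset.card_nbij' Prod.swap Prod.swap ?_ ?_ ?_ ?_
  · intro p hp
    simp only [Finset.coe_filter, mem_bicliques, Set.mem_ofPred_eq, Prod.fst_swap,
      Prod.snd_swap] at hp ⊢
    exact ⟨⟨hp.1.2.1, hp.1.1, fun x hx y hy => (hp.1.2.2 y hy x hx).symm⟩, hp.2⟩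
  · intro p hp
    simp only [Finset.coe_filter, mem_bicliques, Set.mem_ofPred_eq, Prod.fst_swap,
      Prod.snd_swap] at hp ⊢
    exact ⟨⟨hp.1.2.1, hp.1.1, fun x hx y hy => (hp.1.2.2 y hy x hx).symm⟩, hp.2⟩
  · intro p _
    rfl
  · intro p _
    rfl

open Classical in
-- With `v` in the second part, the first part consists of neighbours of `v`; removing `v` leaves a
-- completion of size `t - 1`.
lemma card_bicliques_mem_snd {G : SimpleGraph V} {s t : ℕ} {W : Finset V} {v : V} (hv : v ∉ W)
    (ht : 1 ≤ t) :
    ((bicliques G s t (insert v W)).filter fun p => v ∈ p.2).card =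
      ∑ S ∈ (W.filter fun w => G.Adj v w).powersetCard s, (completions G (t - 1) W S).card := by
  rw [← Finset.card_sigma]
  refine Finset.card_nbij' (fun p => ⟨p.1, p.2.erase v⟩) (fun p => (p.1, insert v p.2)) ?_ ?_ ?_ ?_
  · intro p hp
    simp only [Finset.coe_filter, mem_bicliques, Set.mem_ofPred_eq] at hp
    obtain ⟨⟨⟨h1, h2⟩, ⟨h3, h4⟩, h5⟩, h6⟩ := hp
    simp only [Finset.coe_sigma, Set.mem_sigma_iff, Finset.mem_coe, Finset.mem_powersetCard,
      mem_completions]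
    refine ⟨⟨fun x hx => ?_, h2⟩, ⟨fun x hx => ?_, ?_⟩, fun x hx y hy => ?_⟩
    · have hadj := h5 x hx v h6
      rw [Finset.mem_filter]
      exact ⟨Finset.mem_of_mem_insert_of_ne (h1 hx) hadj.ne, hadj.symm⟩
    · rw [Finset.mem_erase] at hx
      exact Finset.mem_of_mem_insert_of_ne (h3 hx.2) hx.1
    · rw [Finset.card_erase_of_mem h6, h4]
    · exact h5 x hx y (Finset.mem_of_mem_erase hy)
  · rintro ⟨S, T⟩ hp
    simp only [Finset.coe_sigma, Set.mem_sigma_iff, Finset.mem_coe, Finset.mem_powersetCard,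
      mem_completions] at hp
    obtain ⟨⟨h1, h2⟩, ⟨h3, h4⟩, h5⟩ := hp
    simp only [Finset.coe_filter, mem_bicliques, Set.mem_ofPred_eq]
    refine ⟨⟨⟨fun x hx => ?_, h2⟩, ⟨Finset.insert_subset_insert _ h3, ?_⟩, fun x hx y hy => ?_⟩,
      Finset.mem_insert_self _ _⟩
    · exact Finset.mem_insert_of_mem (Finset.mem_filter.mp (h1 hx)).1
    · rw [Finset.card_insert_of_notMem fun h => hv (h3 h), h4]
      omega
    · rcases Finset.mem_insert.mp hy with rfl | hy
      · exact (Finset.mem_filter.mp (h1 hx)).2.symm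
      · exact h5 x hx y hy
  · intro p hp
    simp only [Finset.coe_filter, Set.mem_ofPred_eq] at hp
    simp [Finset.insert_erase hp.2]
  · rintro ⟨S, T⟩ hp
    simp only [Finset.coe_sigma, Set.mem_sigma_iff, Finset.mem_coe, mem_completions] at hp
    simp [Finset.erase_insert fun h => hv (hp.2.1.1 h)]

open Classical in
-- The pairs split by whether `v` lies in neither part, in the second or in the first; looplessness
-- excludes both.
lemma card_bicliques_insert {G : SimpleGraph V} {s t : ℕ} {W : Finset V} {v : V} (hv : v ∉ W)
    (hs : 1 ≤ s) (ht : 1 ≤ t) :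
    (bicliques G s t (insert v W)).card = (bicliques G s t W).card +
      (∑ S ∈ (W.filter fun w => G.Adj v w).powersetCard s, (completions G (t - 1) W S).card +
       ∑ S ∈ (W.filter fun w => G.Adj v w).powersetCard t,
        (completions G (s - 1) W S).card) := by
  rw [← card_bicliques_mem_snd hv ht, ← card_bicliques_mem_snd hv hs,
    ← card_bicliques_swap G s t _ (fun S => v ∈ S), ← Finset.card_union_of_disjoint,
    ← Finset.card_union_of_disjoint]
  · congr 1
    ext p
    simp only [Finset.mem_union, Finset.mem_filter, mem_bicliques]
    constructor
    · rintro ⟨⟨h1, h2⟩, ⟨h3, h4⟩, h5⟩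
      by_cases hv2 : v ∈ p.2
      · exact .inr (.inl ⟨⟨⟨h1, h2⟩, ⟨h3, h4⟩, h5⟩, hv2⟩)
      by_cases hv1 : v ∈ p.1
      · exact .inr (.inr ⟨⟨⟨h1, h2⟩, ⟨h3, h4⟩, h5⟩, hv1⟩)
      · exact .inl ⟨⟨(Finset.subset_insert_iff_of_notMem hv1).mp h1, h2⟩,
          ⟨(Finset.subset_insert_iff_of_notMem hv2).mp h3, h4⟩, h5⟩
    · rintro (⟨⟨h1, h2⟩, ⟨h3, h4⟩, h5⟩ | ⟨h, -⟩ | ⟨h, -⟩)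
      · exact ⟨⟨h1.trans (Finset.subset_insert _ _), h2⟩,
          ⟨h3.trans (Finset.subset_insert _ _), h4⟩, h5⟩
      · exact h
      · exact h
  · rw [Finset.disjoint_left]
    intro p hp hp'
    simp only [Finset.mem_union, Finset.mem_filter, mem_bicliques] at hp hp'
    rcases hp' with hp' | hp'
    · exact hv (hp.2.1.1 hp'.2)
    · exact hv (hp.1.1 hp'.2)
  · rw [Finset.disjoint_left]
    intro p hp hp'
    simp only [Finset.mem_filter, mem_bicliques] at hp hp'
    exact G.irrefl (hp.1.2.2 v hp'.2 v hp.2)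

/-- The bound for the number of bicliques lost with a vertex of degree `d` when `j` vertices
remain. -/
def loss (s t d j : ℕ) : ℕ :=
  d.choose s * (j - s).choose (t - 1) + d.choose t * (j - t).choose (s - 1)

/-- The number of ordered bicliques of a complete graph on `m` vertices. -/
def cliqueCount (s t m : ℕ) : ℕ := m.choose (s + t) * (s + t).choose s

lemma cliqueCount_eq (s t m : ℕ) (ht : 1 ≤ t) :
    cliqueCount s t m = m.choose s * (m - s).choose t := by
  by_cases h : s + t ≤ m
  · have := Nat.choose_mul (n := m) (k := s + t) (s := s) (by omega)
    rw [cliqueCount, this, Nat.add_sub_cancel_left]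
  · rw [cliqueCount, Nat.choose_eq_zero_of_lt (by omega : m < s + t)]
    rcases Nat.lt_or_ge m s with h1 | h1
    · simp [Nat.choose_eq_zero_of_lt h1]
    · simp [Nat.choose_eq_zero_of_lt (by omega : m - s < t)]

lemma card_bicliques_le (G : SimpleGraph V) (s t : ℕ) (ht : 1 ≤ t) (W : Finset V) :
    (bicliques G s t W).card ≤ cliqueCount s t W.card := by
  rw [card_bicliques, cliqueCount_eq _ _ _ ht]
  exact sum_completions_le G s t subset_rfl

lemma card_bicliques_eq {G : SimpleGraph V} (s t : ℕ) (ht : 1 ≤ t) {W : Finset V}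
    (hW : ∀ u ∈ W, ∀ w ∈ W, u ≠ w → G.Adj u w) :
    (bicliques G s t W).card = cliqueCount s t W.card := by
  rw [card_bicliques, cliqueCount_eq _ _ _ ht]
  exact sum_completions_eq s t subset_rfl hW

open Classical in
lemma card_bicliques_insert_le {G : SimpleGraph V} {s t d : ℕ} {W : Finset V} {v : V} (hv : v ∉ W)
    (hs : 1 ≤ s) (ht : 1 ≤ t) (hd : (W.filter fun w => G.Adj v w).card ≤ d) :
    (bicliques G s t (insert v W)).card ≤ (bicliques G s t W).card + loss s t d W.card := by
  rw [card_bicliques_insert hv hs ht, loss]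
  have hN : (W.filter fun w => G.Adj v w) ⊆ W := Finset.filter_subset _ _
  have h1 := sum_completions_le G s (t - 1) hN
  have h2 := sum_completions_le G t (s - 1) hN
  have h3 := Nat.choose_le_choose s hd
  have h4 := Nat.choose_le_choose t hd
  gcongr
  · exact h1.trans (Nat.mul_le_mul_right _ h3)
  · exact h2.trans (Nat.mul_le_mul_right _ h4)

open Classical in
lemma card_bicliques_insert_eq {G : SimpleGraph V} {s t d : ℕ} {W : Finset V} {v : V} (hv : v ∉ W)
    (hs : 1 ≤ s) (ht : 1 ≤ t) (hd : (W.filter fun w => G.Adj v w).card = d)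
    (hdom : ∀ u ∈ W, G.Adj v u → ∀ w ∈ W, u ≠ w → G.Adj u w) :
    (bicliques G s t (insert v W)).card = (bicliques G s t W).card + loss s t d W.card := by
  have hN : (W.filter fun w => G.Adj v w) ⊆ W := Finset.filter_subset _ _
  have hdom' : ∀ u ∈ W.filter (fun w => G.Adj v w), ∀ w ∈ W, u ≠ w → G.Adj u w :=
    fun u hu => hdom u (Finset.mem_filter.mp hu).1 (Finset.mem_filter.mp hu).2
  rw [card_bicliques_insert hv hs ht, loss, sum_completions_eq s (t - 1) hN hdom',
    sum_completions_eq t (s - 1) hN hdom', hd]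

open Classical in
/-- If every set of more than `c` vertices that contains `K` has a vertex outside `K` of degree at
most `d`, then deleting such vertices one by one bounds the number of bicliques. -/
lemma card_bicliques_le_of_degenerate {G : SimpleGraph V} {s t d c : ℕ} (hs : 1 ≤ s) (ht : 1 ≤ t)
    {K : Finset V}
    (hK : ∀ W, K ⊆ W → c < W.card → ∃ v ∈ W, v ∉ K ∧ (W.filter fun w => G.Adj v w).card ≤ d)
    (W : Finset V) (hKW : K ⊆ W) (hc : c ≤ W.card) :
    (bicliques G s t W).card ≤ ∑ j ∈ Finset.Ico c W.card, loss s t d j + cliqueCount s t c := by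
  induction hn : W.card generalizing W with
  | zero =>
    have h0 := card_bicliques_le G s t ht W
    obtain rfl : c = 0 := by omega
    simpa [hn] using h0
  | succ n ih =>
    rcases Nat.lt_or_ge n c with hlt | hge
    · have h0 := card_bicliques_le G s t ht W
      obtain rfl : c = n + 1 := by omega
      simpa [hn] using h0
    · obtain ⟨v, hv, hvK, hdeg⟩ := hK W hKW (by omega)
      have hcard : (W.erase v).card = n := by rw [Finset.card_erase_of_mem hv, hn]; omega
      have h1 := ih (W.erase v) (fun x hx => Finset.mem_erase.mpr ⟨fun h => hvK (h ▸ hx), hKW hx⟩)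
        (by omega) hcard
      have h2 := card_bicliques_insert_le (G := G) (W := W.erase v) (d := d)
        (Finset.notMem_erase v W) hs ht
        ((Finset.card_le_card (Finset.filter_subset_filter _ (Finset.erase_subset _ _))).trans hdeg)
      rw [Finset.insert_erase hv, hcard] at h2
      rw [Finset.sum_Ico_succ_top hge]
      omega

end Counting

/-- The ordered form of `g`. -/
def orderedG (s t n k a : ℕ) : ℕ :=
  ∑ j ∈ Finset.Ico (k - a) n, loss s t a j + cliqueCount s t (k - a)

lemma sum_Icc_sub (f : ℕ → ℕ) {n k a : ℕ} (hkn : k ≤ n) (ha : a ≤ k) :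
    ∑ i ∈ Finset.Icc 1 (n - k + a), f (n - i) = ∑ j ∈ Finset.Ico (k - a) n, f j := by
  refine Finset.sum_nbij' (fun i => n - i) (fun j => n - j) ?_ ?_ ?_ ?_ ?_
  · intro i hi
    rw [Finset.mem_Icc] at hi
    rw [Finset.mem_Ico]
    omega
  · intro i hi
    rw [Finset.mem_Ico] at hi
    rw [Finset.mem_Icc]
    omega
  · intro i hi
    rw [Finset.mem_Icc] at hi
    omega
  · intro i hi
    rw [Finset.mem_Ico] at hi
    omega
  · intro i _
    rfl

/-- The index `i` of `g` numbers the deletions, and `j = n - i` vertices remain after the `i`-th.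
For `s = t` the two terms of `loss` coincide, and the central binomial coefficient is even. -/
lemma g_mul_eq_orderedG {s t n k a : ℕ} (hs : 1 ≤ s) (hkn : k ≤ n) (ha : a ≤ k) :
    g s t n k a * (if s = t then 2 else 1) = orderedG s t n k a := by
  rw [orderedG, ← sum_Icc_sub _ hkn ha, g]
  split_ifs with h
  · subst h
    have heven : 2 ∣ (2 * s).choose s := Nat.two_dvd_centralBinom_of_one_le hs
    have hdiv := Nat.div_mul_cancel (heven.mul_left ((k - a).choose (2 * s)))
    rw [add_mul, hdiv, cliqueCount, ← two_mul s, Finset.sum_mul]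
    congr 1
    refine Finset.sum_congr rfl fun i _ => ?_
    rw [loss, Nat.sub_right_comm]
    ring
  · rw [mul_one, cliqueCount]
    congr 1
    refine Finset.sum_congr rfl fun i _ => ?_
    rw [loss, Nat.sub_right_comm, Nat.sub_right_comm n t i]

/-! ### Copies of `K_{s,t}` as ordered bicliques -/

section CopyCount

variable {V : Type*} [DecidableEq V] {G : SimpleGraph V}

/-- The complete bipartite subgraph with parts `S` and `T`. -/
def bicliqueSubgraph (G : SimpleGraph V) (S T : Finset V) (h : ∀ x ∈ S, ∀ y ∈ T, G.Adj x y) :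
    G.Subgraph where
  verts := {v | v ∈ S ∨ v ∈ T}
  Adj x y := (x ∈ S ∧ y ∈ T) ∨ (x ∈ T ∧ y ∈ S)
  adj_sub := by
    rintro x y (⟨hx, hy⟩ | ⟨hx, hy⟩)
    · exact h x hx y hy
    · exact (h y hy x hx).symm
  edge_vert := by
    rintro x y (⟨hx, hy⟩ | ⟨hx, hy⟩)
    · exact .inl hx
    · exact .inr hx
  symm := ⟨by
    rintro x y (⟨hx, hy⟩ | ⟨hx, hy⟩)
    · exact .inr ⟨hy, hx⟩
    · exact .inl ⟨hy, hx⟩⟩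

/-- Each part is the neighbourhood of any vertex of the other part, so one edge fixes the parts up
to order. -/
lemma bicliqueSubgraph_inj {S T S' T' : Finset V} {h : ∀ x ∈ S, ∀ y ∈ T, G.Adj x y}
    {h' : ∀ x ∈ S', ∀ y ∈ T', G.Adj x y} (hS : S.Nonempty) (hT : T.Nonempty) :
    bicliqueSubgraph G S T h = bicliqueSubgraph G S' T' h' ↔
      (S' = S ∧ T' = T) ∨ (S' = T ∧ T' = S) := by
  constructor
  · intro heq
    have hadj : ∀ x y, (x ∈ S ∧ y ∈ T) ∨ (x ∈ T ∧ y ∈ S) ↔ (x ∈ S' ∧ y ∈ T') ∨ (x ∈ T' ∧ y ∈ S') := by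
      intro x y
      have := congrArg (fun K => K.Adj x y) heq
      exact Iff.of_eq this
    have hd : ∀ x ∈ S, x ∉ T := fun x hx hx' => G.irrefl (h x hx x hx')
    have hd' : ∀ x ∈ S', x ∉ T' := fun x hx hx' => G.irrefl (h' x hx x hx')
    obtain ⟨a, ha⟩ := hS
    obtain ⟨b, hb⟩ := hT
    rcases (hadj a b).mp (.inl ⟨ha, hb⟩) with ⟨ha', hb'⟩ | ⟨ha', hb'⟩
    · left
      constructor
      · ext x
        have := hadj x b
        have := hd b
        have := hd' b
        tauto
      · ext x
        have := hadj a x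
        have := hd a
        have := hd' a
        tauto
    · right
      constructor
      · ext x
        have := hadj a x
        have := hd a
        have := hd' a
        tauto
      · ext x
        have := hadj x b
        have := hd b
        have := hd' b
        tauto
  · rintro (⟨rfl, rfl⟩ | ⟨rfl, rfl⟩)
    · rfl
    · ext x y
      · exact or_comm
      · exact or_comm

lemma exists_copy_iff {s t : ℕ} (K : G.Subgraph) :
    (∃ f : SimpleGraph.Copy (completeBipartiteGraph (Fin s) (Fin t)) G, f.toSubgraph = K) ↔
      ∃ S T : Finset V, ∃ h : ∀ x ∈ S, ∀ y ∈ T, G.Adj x y, S.card = s ∧ T.card = t ∧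
        bicliqueSubgraph G S T h = K := by
  constructor
  · rintro ⟨f, rfl⟩
    have hinj : Function.Injective f := f.injective
    have hf : ∀ x y, (completeBipartiteGraph (Fin s) (Fin t)).Adj x y → G.Adj (f x) (f y) :=
      fun x y hxy => f.toHom.map_adj hxy
    refine ⟨Finset.univ.image fun i => f (.inl i), Finset.univ.image fun i => f (.inr i), ?_, ?_, ?_,
      ?_⟩
    · simp only [Finset.mem_image, Finset.mem_univ, true_and]
      rintro _ ⟨i, rfl⟩ _ ⟨j, rfl⟩
      exact hf _ _ (by simp)
    · rw [Finset.card_image_of_injective _ fun i j hij => Sum.inl_injective (hinj hij)]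
      simp
    · rw [Finset.card_image_of_injective _ fun i j hij => Sum.inr_injective (hinj hij)]
      simp
    · ext x y
      · simp [bicliqueSubgraph, SimpleGraph.Copy.toSubgraph]
      · simp [bicliqueSubgraph, SimpleGraph.Copy.toSubgraph, Relation.Map]
  · rintro ⟨S, T, h, rfl, rfl, rfl⟩
    let φ : Fin S.card ⊕ Fin T.card → V :=
      Sum.elim (fun i => S.equivFin.symm i) (fun i => T.equivFin.symm i)
    have hadj : ∀ i j, G.Adj (S.equivFin.symm i) (T.equivFin.symm j) :=
      fun i j => h _ (S.equivFin.symm i).2 _ (T.equivFin.symm j).2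
    let F : completeBipartiteGraph (Fin S.card) (Fin T.card) →g G :=
      ⟨φ, by
        rintro (i | i) (j | j) hij
        · simp at hij
        · exact hadj i j
        · exact (hadj j i).symm
        · simp at hij⟩
    have hinj : Function.Injective F := by
      rintro (i | i) (j | j) hij
      · have : S.equivFin.symm i = S.equivFin.symm j := Subtype.ext hij
        rw [S.equivFin.symm.injective this]
      · exact absurd hij (hadj i j).ne
      · exact absurd hij (hadj j i).ne'
      · have : T.equivFin.symm i = T.equivFin.symm j := Subtype.ext hij
        rw [T.equivFin.symm.injective this]
    have hS : ∀ x, x ∈ S ↔ ∃ i, (S.equivFin.symm i : V) = x := fun x =>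
      ⟨fun hx => ⟨S.equivFin ⟨x, hx⟩, by simp⟩, by rintro ⟨i, rfl⟩; exact (S.equivFin.symm i).2⟩
    have hT : ∀ x, x ∈ T ↔ ∃ i, (T.equivFin.symm i : V) = x := fun x =>
      ⟨fun hx => ⟨T.equivFin ⟨x, hx⟩, by simp⟩, by rintro ⟨i, rfl⟩; exact (T.equivFin.symm i).2⟩
    refine ⟨⟨F, hinj⟩, ?_⟩
    ext x y
    · simp only [SimpleGraph.Copy.toSubgraph, SimpleGraph.Subgraph.map_verts,
        SimpleGraph.Subgraph.verts_top, Set.image_univ, Set.mem_range, Sum.exists]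
      exact or_congr (hS x).symm (hT x).symm
    · simp only [SimpleGraph.Copy.toSubgraph, SimpleGraph.Subgraph.map_adj, Relation.Map,
        SimpleGraph.Subgraph.top_adj, Sum.exists]
      change _ ↔ (x ∈ S ∧ y ∈ T) ∨ (x ∈ T ∧ y ∈ S)
      rw [hS, hT, hS, hT]
      constructor
      · rintro (⟨i, ⟨j, hij, -⟩ | ⟨j, -, h1, h2⟩⟩ | ⟨i, ⟨j, -, h1, h2⟩ | ⟨j, hij, -⟩⟩)
        · simp at hij
        · exact .inl ⟨⟨i, h1⟩, ⟨j, h2⟩⟩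
        · exact .inr ⟨⟨i, h1⟩, ⟨j, h2⟩⟩
        · simp at hij
      · rintro (⟨⟨i, h1⟩, ⟨j, h2⟩⟩ | ⟨⟨i, h1⟩, ⟨j, h2⟩⟩)
        · exact .inl ⟨i, .inr ⟨j, by simp, h1, h2⟩⟩
        · exact .inr ⟨i, .inl ⟨j, by simp, h1, h2⟩⟩

/-- The map from ordered pairs to subgraphs has fibres `{(S, T), (T, S)}` if `s = t`; otherwise the
sizes fix the order and the fibres are singletons. -/
lemma numK_mul [Fintype V] (G : SimpleGraph V) {s t : ℕ} (hs : 1 ≤ s) (ht : 1 ≤ t) :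
    numK s t G * (if s = t then 2 else 1) = (bicliques G s t Finset.univ).card := by
  classical
  let F : Finset V × Finset V → G.Subgraph := fun p =>
    if h : ∀ x ∈ p.1, ∀ y ∈ p.2, G.Adj x y then bicliqueSubgraph G p.1 p.2 h else ⊥
  have hF : ∀ p (h : ∀ x ∈ p.1, ∀ y ∈ p.2, G.Adj x y), F p = bicliqueSubgraph G p.1 p.2 h :=
    fun p h => dif_pos h
  have himage : (Finset.univ : Finset (SimpleGraph.Copy (completeBipartiteGraph (Fin s) (Fin t))
      G)).image SimpleGraph.Copy.toSubgraph = (bicliques G s t Finset.univ).image F := by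
    ext K
    rw [Finset.mem_image, Finset.mem_image]
    have := exists_copy_iff (s := s) (t := t) K
    simp only [Finset.mem_univ, true_and, this, Prod.exists, mem_bicliques, Finset.subset_univ]
    constructor
    · rintro ⟨S, T, h, h1, h2, h3⟩
      exact ⟨S, T, ⟨h1, h2, h⟩, (hF (S, T) h).trans h3⟩
    · rintro ⟨S, T, ⟨h1, h2, h⟩, h3⟩
      exact ⟨S, T, h, h1, h2, (hF (S, T) h).symm.trans h3⟩
  rw [numK, SimpleGraph.copyCount_eq_card_image_copyToSubgraph, himage,
    Finset.card_eq_sum_card_image F (bicliques G s t Finset.univ), ← smul_eq_mul,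
    ← Finset.sum_const]
  refine Finset.sum_congr rfl fun K hK => ?_
  obtain ⟨⟨S, T⟩, hST, rfl⟩ := Finset.mem_image.mp hK
  obtain ⟨⟨-, h1⟩, ⟨-, h2⟩, h3⟩ := mem_bicliques.mp hST
  have hS : S.Nonempty := Finset.card_pos.mp (by simp only at h1; omega)
  have hT : T.Nonempty := Finset.card_pos.mp (by simp only at h2; omega)
  have hne : S ≠ T := by
    rintro rfl
    obtain ⟨a, ha⟩ := hS
    exact G.irrefl (h3 a ha a ha)
  simp only at h1 h2
  have hfiber : ∀ p ∈ bicliques G s t Finset.univ, F p = F (S, T) ↔ p = (S, T) ∨ p = (T, S) := by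
    rintro ⟨S', T'⟩ hp
    have h4 := (mem_bicliques.mp hp).2.2
    rw [hF _ h4, hF _ h3, eq_comm, bicliqueSubgraph_inj hS hT, Prod.mk.injEq, Prod.mk.injEq]
  split_ifs with hst
  · subst hst
    rw [show (bicliques G s s Finset.univ).filter (fun p => F p = F (S, T)) = {(S, T), (T, S)} from ?_,
      Finset.card_pair (by simp [hne])]
    ext p
    rw [Finset.mem_filter, Finset.mem_insert, Finset.mem_singleton]
    constructor
    · rintro ⟨hp, h⟩
      exact (hfiber p hp).mp h
    · intro h
      have hp : p ∈ bicliques G s s Finset.univ := by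
        rcases h with rfl | rfl
        · exact hST
        · rw [mem_bicliques]
          exact ⟨⟨Finset.subset_univ _, h2⟩, ⟨Finset.subset_univ _, h1⟩,
            fun x hx y hy => (h3 y hy x hx).symm⟩
      exact ⟨hp, (hfiber p hp).mpr h⟩
  · rw [show (bicliques G s t Finset.univ).filter (fun p => F p = F (S, T)) = {(S, T)} from ?_,
      Finset.card_singleton]
    ext p
    rw [Finset.mem_filter, Finset.mem_singleton]
    constructor
    · rintro ⟨hp, h⟩
      rcases (hfiber p hp).mp h with rfl | rfl
      · rfl
      · have := (mem_bicliques.mp hp).1.2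
        simp only at this
        omega
    · rintro rfl
      exact ⟨hST, rfl⟩

end CopyCount

/-! ### Convexity of the bound in the parameter `a` -/

section Convexity

lemma choose_two_step (n j : ℕ) :
    (n + 2).choose (j + 2) + n.choose (j + 2) = 2 * (n + 1).choose (j + 2) + n.choose j := by
  rw [Nat.choose_succ_succ' (n + 1) (j + 1), Nat.choose_succ_succ' n j,
    Nat.choose_succ_succ' n (j + 1)]
  ring

lemma two_mul_choose_le (n j : ℕ) :
    2 * (n + 1).choose j ≤ (n + 2).choose j + n.choose j := by
  match j with
  | 0 => simp
  | 1 => simp; omega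
  | j + 2 => have := choose_two_step n j; omega

/-- One half of the sum in `orderedG`. -/
lemma half_convex {s t b m n : ℕ} (ht : 1 ≤ t) (hb : b + 1 ≤ m) (hmn : m + 2 ≤ n) :
    2 * ((b + 1).choose s * ∑ j ∈ Finset.Ico (m + 1) n, (j - s).choose (t - 1)) ≤
      b.choose s * ∑ j ∈ Finset.Ico (m + 2) n, (j - s).choose (t - 1) +
      (b + 2).choose s * ∑ j ∈ Finset.Ico m n, (j - s).choose (t - 1) +
      if 2 ≤ t then m.choose s * (m - s).choose (t - 2) else 0 := by
  rw [Finset.sum_eq_sum_Ico_succ_bot (by omega : m < n),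
    Finset.sum_eq_sum_Ico_succ_bot (by omega : m + 1 < n)]
  generalize ∑ j ∈ Finset.Ico (m + 1 + 1) n, (j - s).choose (t - 1) = E
  have hmono : (b + 1).choose s ≤ (b + 2).choose s := Nat.choose_le_choose s (by omega)
  have hconv := two_mul_choose_le b s
  -- Convexity of binomial coefficients handles the common tail `E`; the term at `m + 1` has to be
  -- compared with the one at `m`. By Pascal's rule this costs a correction, which the guard keeps
  -- at `0` for `t = 1`.
  have hstep : (b + 1).choose s * (m + 1 - s).choose (t - 1) ≤
      (b + 1).choose s * (m - s).choose (t - 1) +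
        if 2 ≤ t then m.choose s * (m - s).choose (t - 2) else 0 := by
    rcases Nat.lt_or_ge m s with h | h
    · rw [show m + 1 - s = 0 by omega, show m - s = 0 by omega]
      omega
    · split_ifs with h2
      · obtain ⟨t, rfl⟩ := Nat.exists_eq_add_of_le h2
        rw [show m + 1 - s = m - s + 1 by omega, show 2 + t - 1 = t + 1 by omega,
          show 2 + t - 2 = t by omega, Nat.choose_succ_succ']
        have := Nat.mul_le_mul_right ((m - s).choose t) (Nat.choose_le_choose s hb)
        linarith [mul_add ((b + 1).choose s) ((m - s).choose t) ((m - s).choose (t + 1))]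
      · obtain rfl : t = 1 := by omega
        simp
  have h1 := Nat.mul_le_mul_right E hconv
  have h2 := Nat.mul_le_mul_right ((m + 1 - s).choose (t - 1) + (m - s).choose (t - 1)) hmono
  nlinarith

/-- The corrections from the two halves of the sum are absorbed here. With `j = s + t - 2` the
second difference of `cliqueCount` is `m.choose j * (j + 2).choose s`, and the corrections are at
most `m.choose j` times `j.choose s` and `j.choose (s - 2)`, two distinct terms of the Pascal
expansion of `(j + 2).choose s`. -/
lemma cliqueCount_convex {s t : ℕ} (hs : 1 ≤ s) (ht : 1 ≤ t) (m : ℕ) :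
    2 * cliqueCount s t (m + 1) + ((if 2 ≤ t then m.choose s * (m - s).choose (t - 2) else 0) +
      (if 2 ≤ s then m.choose t * (m - t).choose (s - 2) else 0)) ≤
      cliqueCount s t (m + 2) + cliqueCount s t m := by
  obtain ⟨j, hj⟩ : ∃ j, s + t = j + 2 := ⟨s + t - 2, by omega⟩
  have hone : (if 2 ≤ t then m.choose s * (m - s).choose (t - 2) else 0) +
      (if 2 ≤ s then m.choose t * (m - t).choose (s - 2) else 0) ≤
      m.choose j * (s + t).choose s := by
    have key : ∀ s t : ℕ, s + t = j + 2 → 2 ≤ t →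
        m.choose s * (m - s).choose (t - 2) = m.choose j * j.choose s := by
      intro s t hst h2
      rcases Nat.lt_or_ge m j with h | h
      · rw [Nat.choose_eq_zero_of_lt h, zero_mul]
        rcases Nat.lt_or_ge m s with h' | h'
        · rw [Nat.choose_eq_zero_of_lt h', zero_mul]
        · rw [Nat.choose_eq_zero_of_lt (by omega : m - s < t - 2), mul_zero]
      · rw [Nat.choose_mul (by omega : s ≤ j), show j - s = t - 2 by omega]
    have h1 : (if 2 ≤ t then m.choose s * (m - s).choose (t - 2) else 0) ≤
        m.choose j * j.choose s := by
      split_ifs with h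
      · exact (key s t hj h).le
      · exact Nat.zero_le _
    have h2 : (if 2 ≤ s then m.choose t * (m - t).choose (s - 2) else 0) ≤
        m.choose j * (j + 1).choose (s - 1) := by
      split_ifs with h
      · rw [key t s (by omega) h]
        refine Nat.mul_le_mul_left _ ?_
        obtain ⟨s, rfl⟩ := Nat.exists_eq_add_of_le h
        have : j.choose t = j.choose s := Nat.choose_symm_of_eq_add (by omega)
        rw [this, show 2 + s - 1 = s + 1 by omega, Nat.choose_succ_succ']
        omega
      · exact Nat.zero_le _
    refine (Nat.add_le_add h1 h2).trans ?_
    rw [← mul_add, hj]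
    refine Nat.mul_le_mul_left _ ?_
    obtain ⟨s, rfl⟩ := Nat.exists_eq_add_of_le hs
    rw [add_comm 1 s, Nat.add_sub_cancel, Nat.choose_succ_succ' (j + 1) s]
    have := Nat.choose_le_choose (s + 1) (by omega : j ≤ j + 1)
    omega
  have h := choose_two_step m j
  rw [← hj] at h
  have h' := congrArg (· * (s + t).choose s) h
  simp only [add_mul] at h'
  simp only [cliqueCount]
  linarith

lemma orderedG_convex {s t n k b : ℕ} (hs : 1 ≤ s) (ht : 1 ≤ t) (hkn : k ≤ n)
    (hb : 2 * b + 3 ≤ k) :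
    2 * orderedG s t n k (b + 1) ≤ orderedG s t n k b + orderedG s t n k (b + 2) := by
  obtain ⟨m, rfl⟩ : ∃ m, k = m + 2 + b := ⟨k - 2 - b, by omega⟩
  have h1 := half_convex (s := s) (t := t) (b := b) (m := m) (n := n) ht (by omega) (by omega)
  have h2 := half_convex (s := t) (t := s) (b := b) (m := m) (n := n) hs (by omega) (by omega)
  have h3 := cliqueCount_convex hs ht m
  simp only [orderedG, loss, Finset.sum_add_distrib, ← Finset.mul_sum]
  rw [show m + 2 + b - (b + 1) = m + 1 by omega, show m + 2 + b - b = m + 2 by omega,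
    show m + 2 + b - (b + 2) = m by omega]
  omega

lemma le_max_of_convex {f : ℕ → ℕ} {r h : ℕ}
    (hf : ∀ b, r ≤ b → b + 2 ≤ h → 2 * f (b + 1) ≤ f b + f (b + 2)) {a : ℕ} (hra : r ≤ a)
    (hah : a ≤ h) : f a ≤ max (f r) (f h) := by
  -- A value above `f r` has been reached by increasing, and convexity keeps the sequence from
  -- decreasing afterwards.
  have step : ∀ b, r ≤ b → b + 1 ≤ h → f b ≤ max (f r) (f (b + 1)) := by
    intro b hb
    induction b, hb using Nat.le_induction with
    | base => intro _; exact le_max_left _ _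
    | succ b hb ih =>
      intro hbh
      have h1 := ih (by omega)
      have h2 := hf b hb hbh
      change f (b + 1) ≤ max (f r) (f (b + 2))
      omega
  induction h, hah using Nat.le_induction with
  | base => exact le_max_right _ _
  | succ h hah ih =>
    have h1 := ih (fun b hb hbh => hf b hb (by omega)) (fun b hb hbh => step b hb (by omega))
    have h2 := step h (by omega) le_rfl
    omega

end Convexity

/-! ### Edge-maximal graphs without long cycles -/

section Saturation

variable {V : Type*} [DecidableEq V] {G : SimpleGraph V}

omit [DecidableEq V] in
lemma edges_subset_of_sup_edge {u v a b : V} (q : (G ⊔ SimpleGraph.edge u v).Walk a b)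
    (he : s(u, v) ∉ q.edges) : ∀ e ∈ q.edges, e ∈ G.edgeSet := by
  intro e heq
  have hmem := q.edges_subset_edgeSet heq
  induction e with
  | _ x y =>
    rw [SimpleGraph.mem_edgeSet, SimpleGraph.sup_adj, SimpleGraph.edge_adj] at hmem
    rcases hmem with h | ⟨⟨rfl, rfl⟩ | ⟨rfl, rfl⟩, -⟩
    · exact h
    · exact absurd heq he
    · exact absurd (Sym2.eq_swap ▸ heq) he

lemma PathOn.of_walk_sup_edge {u v a b : V} (q : (G ⊔ SimpleGraph.edge u v).Walk a b)
    (hq : q.IsPath) (he : s(u, v) ∉ q.edges) : PathOn G a b q.support.toFinset := by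
  have h := edges_subset_of_sup_edge q he
  have := PathOn.of_walk (q.transfer G h) (hq.transfer h)
  rwa [SimpleGraph.Walk.support_transfer] at this

/-- A long cycle created by a new edge gives a long path between the ends of this edge. -/
lemma exists_pathOn_of_hasCycle_sup_edge {u v : V} {k : ℕ} (hnc : ¬ HasCycleOfLengthAtLeast G k)
    (hc : HasCycleOfLengthAtLeast (G ⊔ SimpleGraph.edge u v) k) :
    ∃ S, PathOn G u v S ∧ k ≤ S.card := by
  obtain ⟨w, p, hp, hk⟩ := hc
  have hmem : s(u, v) ∈ p.edges := by
    by_contra he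
    have h := edges_subset_of_sup_edge p he
    exact hnc ⟨w, p.transfer G h, hp.transfer h, by simpa using hk⟩
  have hu : u ∈ p.support := p.fst_mem_support_of_mem_edges hmem
  have hc := hp.rotate hu
  have hlen : (p.rotate u hu).length = p.length := by simp
  have he : s(u, v) ∈ (p.rotate u hu).edges := (p.rotate_edges u hu).mem_iff.mpr hmem
  rw [← hlen] at hk
  clear hlen hmem
  generalize p.rotate u hu = c at *
  cases c with
  | nil => simp at he
  | @cons _ x _ hux q =>
    obtain ⟨hq, hxe⟩ := (SimpleGraph.Walk.cons_isCycle_iff _ _).mp hc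
    rw [SimpleGraph.Walk.length_cons] at hk
    -- After rotation to `u`, the new edge is the first or the last edge of the cycle; the remaining
    -- edges form the path.
    by_cases hxv : x = v
    · subst hxv
      refine ⟨_, (PathOn.of_walk_sup_edge q hq hxe).reverse, ?_⟩
      rwa [List.toFinset_card_of_nodup hq.support_nodup, SimpleGraph.Walk.length_support]
    · have he' : s(u, v) ∈ q.reverse.edges := by
        rw [SimpleGraph.Walk.edges_cons, List.mem_cons] at he
        rw [SimpleGraph.Walk.edges_reverse, List.mem_reverse]
        refine he.resolve_left fun h => ?_
        simp only [Sym2.eq_iff] at h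
        have := hux.ne
        grind
      have hq' := hq.reverse
      have hlen : q.reverse.length = q.length := by simp
      rw [← hlen] at hk
      generalize q.reverse = q' at *
      cases q' with
      | nil => simp at he'
      | @cons _ y _ huy q' =>
        rw [SimpleGraph.Walk.cons_isPath_iff] at hq'
        rw [SimpleGraph.Walk.edges_cons, List.mem_cons] at he'
        have hvy : v = y := by
          rcases he' with h | h
          · simp only [Sym2.eq_iff] at h
            have := huy.ne
            grind
          · exact absurd (q'.fst_mem_support_of_mem_edges h) hq'.2
        subst hvy
        have h1 := PathOn.of_walk_sup_edge q' hq'.1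
          fun h => hq'.2 (q'.fst_mem_support_of_mem_edges h)
        have hxu : G.Adj x u := by
          rw [SimpleGraph.sup_adj, SimpleGraph.edge_adj] at hux
          have := huy.ne
          rcases hux with h | h
          · exact h.symm
          · grind
        have h2 := h1.bridge hxu (.single u) (by simpa using hq'.2)
        refine ⟨_, h2.reverse, ?_⟩
        rw [Finset.card_union_of_disjoint (by simpa using hq'.2),
          List.toFinset_card_of_nodup hq'.1.support_nodup, SimpleGraph.Walk.length_support,
          Finset.card_singleton]
        simpa using hk

/-- Any two nonadjacent vertices are the ends of a path on at least `k` vertices. -/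
def Saturated (G : SimpleGraph V) (k : ℕ) : Prop :=
  ∀ u v, u ≠ v → ¬ G.Adj u v → ∃ S, PathOn G u v S ∧ k ≤ S.card

lemma exists_saturated [Finite V] {k : ℕ} (hnc : ¬ HasCycleOfLengthAtLeast G k) :
    ∃ G', G ≤ G' ∧ ¬ HasCycleOfLengthAtLeast G' k ∧ Saturated G' k := by
  obtain ⟨G', hGG', hmax⟩ := Finite.exists_le_maximal
    (p := fun G : SimpleGraph V => ¬ HasCycleOfLengthAtLeast G k) hnc
  refine ⟨G', hGG', hmax.prop, fun u v huv hadj => ?_⟩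
  refine exists_pathOn_of_hasCycle_sup_edge hmax.prop ?_
  by_contra h
  have hle : G' ⊔ SimpleGraph.edge u v ≤ G' := hmax.2 h le_sup_left
  exact hadj (hle (by simp [SimpleGraph.edge_adj, huv]))

end Saturation

/-! ### Kopylov's disintegration -/

section Core

variable {V : Type*} [Fintype V] [DecidableEq V] (G : SimpleGraph V)

open Classical in
/-- The largest set of vertices that induces a subgraph of minimum degree more than `d`. -/
noncomputable def core (d : ℕ) : Finset V :=
  Finset.univ.filter fun v =>
    ∃ W : Finset V, v ∈ W ∧ ∀ w ∈ W, d < (W.filter fun x => G.Adj w x).card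

variable {G}

open Classical in
lemma subset_core {d : ℕ} {W : Finset V} (h : ∀ w ∈ W, d < (W.filter fun x => G.Adj w x).card) :
    W ⊆ core G d := fun v hv => by
  rw [core, Finset.mem_filter]
  exact ⟨Finset.mem_univ _, W, hv, h⟩

open Classical in
lemma lt_card_core {d : ℕ} {v : V} (hv : v ∈ core G d) :
    d < ((core G d).filter fun x => G.Adj v x).card := by
  obtain ⟨-, W, hvW, hW⟩ := Finset.mem_filter.mp hv
  exact (hW v hvW).trans_le
    (Finset.card_le_card (Finset.filter_subset_filter _ (subset_core hW)))

open Classical in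
-- Otherwise `W` would have minimum degree more than `d`, against the maximality of the core.
lemma exists_not_mem_core {d : ℕ} {W : Finset V} (hW : core G d ⊆ W) (hne : W ≠ core G d) :
    ∃ v ∈ W, v ∉ core G d ∧ (W.filter fun x => G.Adj v x).card ≤ d := by
  by_contra! h
  refine hne (Finset.Subset.antisymm (subset_core fun w hw => ?_) hW)
  by_cases hwc : w ∈ core G d
  · exact (lt_card_core hwc).trans_le (Finset.card_le_card (Finset.filter_subset_filter _ hW))
  · exact h w hw hwc

open Classical in
/-- If the sets `A` and `B` induce subgraphs of minimum degrees with sum at least `k`, then they are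
completely joined. -/
lemma adj_of_degree {k dA dB : ℕ} {A B : Finset V} (hk : 3 ≤ k) (hG : Unseparable G)
    (hnc : ¬ HasCycleOfLengthAtLeast G k) (hsat : Saturated G k) (hd : k ≤ dA + dB)
    (hA : ∀ u ∈ A, dA ≤ (A.filter fun x => G.Adj u x).card)
    (hB : ∀ v ∈ B, dB ≤ (B.filter fun x => G.Adj v x).card) :
    ∀ u ∈ A, ∀ v ∈ B, u ≠ v → G.Adj u v := by
  by_contra! hne
  obtain ⟨u₀, hu₀, v₀, hv₀, huv₀, hadj₀⟩ := hne
  obtain ⟨S₀, hS₀, hkS₀⟩ := hsat u₀ v₀ huv₀ hadj₀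
  let paths : Finset (Finset V) := Finset.univ.filter fun S =>
    ∃ u ∈ A, ∃ v ∈ B, u ≠ v ∧ ¬ G.Adj u v ∧ PathOn G u v S
  have hmem : ∀ S, S ∈ paths ↔ ∃ u ∈ A, ∃ v ∈ B, u ≠ v ∧ ¬ G.Adj u v ∧ PathOn G u v S := by
    intro S
    simp [paths]
  -- For a longest path between nonadjacent vertices of `A` and `B`, a neighbour in `A` of the end
  -- `u` off the path would close a long cycle or lengthen the path; likewise at `v`. So the counted
  -- neighbours all lie on the path and Pósa's lemma applies.
  obtain ⟨S, hS, hmax⟩ := paths.exists_max_image Finset.card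
    ⟨S₀, (hmem _).mpr ⟨u₀, hu₀, v₀, hv₀, huv₀, hadj₀, hS₀⟩⟩
  have hkS : k ≤ S.card :=
    hkS₀.trans (hmax S₀ ((hmem _).mpr ⟨u₀, hu₀, v₀, hv₀, huv₀, hadj₀, hS₀⟩))
  obtain ⟨u, hu, v, hv, huv, hadj, hP⟩ := (hmem _).mp hS
  have hu1 : ∀ w ∈ A, G.Adj u w → w ∈ S := by
    intro w hw huw
    by_contra hwS
    have hP' : PathOn G w v (insert w S) := .cons huw.symm hwS hP
    have hcard := Finset.card_insert_of_notMem hwS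
    have hwv : w ≠ v := fun h => hwS (h ▸ hP.right_mem)
    by_cases hwv' : G.Adj w v
    · exact hnc ((hP'.hasCycle hwv'.symm (by omega)).mono (by omega))
    · have := hmax _ ((hmem _).mpr ⟨w, hw, v, hv, hwv, hwv', hP'⟩)
      omega
  have hv1 : ∀ w ∈ B, G.Adj v w → w ∈ S := by
    intro w hw hvw
    by_contra hwS
    have hP' : PathOn G w u (insert w S) := .cons hvw.symm hwS hP.reverse
    have hcard := Finset.card_insert_of_notMem hwS
    have hwu : w ≠ u := fun h => hwS (h ▸ hP.left_mem)
    by_cases hwu' : G.Adj w u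
    · exact hnc ((hP'.hasCycle hwu'.symm (by omega)).mono (by omega))
    · have := hmax _ ((hmem _).mpr ⟨u, hu, w, hw, hwu.symm, fun h => hwu' h.symm, hP'.reverse⟩)
      omega
  refine hnc (hP.hasCycle_of_degree hG hk hkS (A := A.filter fun x => G.Adj u x)
    (B := B.filter fun x => G.Adj v x) ?_ ?_ (hd.trans (Nat.add_le_add (hA u hu) (hB v hv))))
  · intro w hw
    rw [Finset.mem_filter] at hw
    exact ⟨hu1 w hw.1 hw.2, hw.2⟩
  · intro w hw
    rw [Finset.mem_filter] at hw
    exact ⟨hv1 w hw.1 hw.2, hw.2⟩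

omit [Fintype V] in
lemma exists_pathOn_of_clique {S : Finset V} (hS : ∀ u ∈ S, ∀ v ∈ S, u ≠ v → G.Adj u v)
    (hne : S.Nonempty) : ∃ a ∈ S, ∃ b ∈ S, PathOn G a b S := by
  induction hne using Finset.Nonempty.cons_induction with
  | singleton a => exact ⟨a, by simp, a, by simp, .single a⟩
  | cons a S ha hne ih =>
    rw [Finset.cons_eq_insert] at hS ⊢
    obtain ⟨c, hc, b, hb, h⟩ := ih fun u hu v hv =>
      hS u (Finset.mem_insert_of_mem hu) v (Finset.mem_insert_of_mem hv)
    have hac : a ≠ c := fun h => ha (h ▸ hc)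
    exact ⟨a, by simp, b, by simp [hb], .cons (hS a (by simp) c (by simp [hc]) hac) ha h⟩

omit [Fintype V] in
lemma hasCycle_of_clique {S : Finset V} (hS : ∀ u ∈ S, ∀ v ∈ S, u ≠ v → G.Adj u v)
    (hc : 3 ≤ S.card) : HasCycleOfLengthAtLeast G S.card := by
  obtain ⟨a, ha, b, hb, h⟩ := exists_pathOn_of_clique hS (Finset.card_pos.mp (by omega))
  refine h.hasCycle (hS b hb a ha ?_) hc
  rintro rfl
  cases h with
  | single => simp at hc
  | cons _ hb' h => exact hb' h.right_mem

open Classical in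
-- A vertex outside the core but joined to all of it has at least as many neighbours there as any
-- core vertex, so adding it would enlarge the core.
lemma mem_core_of_forall_adj {d : ℕ} {v : V} (hne : (core G d).Nonempty)
    (hv : ∀ u ∈ core G d, u ≠ v → G.Adj u v) : v ∈ core G d := by
  have h : insert v (core G d) ⊆ core G d := by
    by_cases hvc : v ∈ core G d
    · rw [Finset.insert_eq_of_mem hvc]
    refine subset_core fun w hw => ?_
    rcases Finset.mem_insert.mp hw with rfl | hw
    · obtain ⟨u, hu⟩ := hne
      have h1 : (core G d).filter (fun x => G.Adj u x) ⊆
          (insert w (core G d)).filter fun x => G.Adj w x := by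
        intro x hx
        have hxc := (Finset.mem_filter.mp hx).1
        exact Finset.mem_filter.mpr ⟨Finset.mem_insert_of_mem hxc,
          (hv x hxc fun h => hvc (h ▸ hxc)).symm⟩
      exact (lt_card_core hu).trans_le (Finset.card_le_card h1)
    · exact (lt_card_core hw).trans_le
        (Finset.card_le_card (Finset.filter_subset_filter _ (Finset.subset_insert _ _)))
  exact h (Finset.mem_insert_self _ _)

open Classical in
/-- The bound of Kopylov's disintegration argument. -/
lemma exists_card_bicliques_le {s t k r : ℕ} (hs : 1 ≤ s) (ht : 1 ≤ t) (hk : 5 ≤ k)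
    (hkn : k ≤ Fintype.card V) (hG : Unseparable G) (hnc : ¬ HasCycleOfLengthAtLeast G k)
    (hsat : Saturated G k) (hdeg : ∀ v, r ≤ (Finset.univ.filter fun x => G.Adj v x).card) :
    ∃ a, a ≤ (k - 1) / 2 ∧ (r ≤ a ∨ a = (k - 1) / 2) ∧
      (bicliques G s t Finset.univ).card ≤ orderedG s t (Fintype.card V) k a := by
  obtain ⟨h, hh⟩ : ∃ h, h = (k - 1) / 2 := ⟨_, rfl⟩
  rw [← hh]
  have hcardV : (Finset.univ : Finset V).card = Fintype.card V := Finset.card_univ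
  rcases (core G h).eq_empty_or_nonempty with hempty | hne
  · refine ⟨h, le_rfl, .inr rfl, ?_⟩
    have := card_bicliques_le_of_degenerate (G := G) (d := h) (c := k - h) (K := ∅) hs ht
      (fun W _ hW => by
        obtain ⟨v, hv, hvc, hvd⟩ := exists_not_mem_core (G := G) (d := h) (W := W) (by simp [hempty])
          (fun h0 => by rw [h0, hempty] at hW; simp at hW)
        exact ⟨v, hv, by simp, hvd⟩)
      Finset.univ (by simp) (by omega)
    rwa [hcardV] at this
  · have hclique : ∀ u ∈ core G h, ∀ v ∈ core G h, u ≠ v → G.Adj u v :=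
      adj_of_degree (dA := h + 1) (dB := h + 1) (by omega) hG hnc hsat (by omega)
        (fun u hu => lt_card_core hu) fun u hu => lt_card_core hu
    have hfil : ∀ u ∈ core G h, (core G h).filter (fun x => G.Adj u x) = (core G h).erase u := by
      intro u hu
      ext x
      rw [Finset.mem_filter, Finset.mem_erase]
      exact ⟨fun hx => ⟨hx.2.ne', hx.1⟩, fun hx => ⟨hx.2, hclique u hu x hx.2 hx.1.symm⟩⟩
    have hdegC : ∀ u ∈ core G h,
        ((core G h).filter fun x => G.Adj u x).card = (core G h).card - 1 := by
      intro u hu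
      rw [hfil u hu, Finset.card_erase_of_mem hu]
    have hl : h + 2 ≤ (core G h).card := by
      obtain ⟨u, hu⟩ := hne
      have h1 := lt_card_core hu
      rw [hdegC u hu] at h1
      omega
    have hlk : (core G h).card < k := by
      by_contra! hlk
      exact hnc ((hasCycle_of_clique hclique (by omega)).mono hlk)
    -- Otherwise the clique, of degree `l - 1`, would be joined to every vertex of `V`. Then `V`
    -- would be the core, which has fewer than `k` vertices.
    have hlr : (core G h).card + r ≤ k := by
      by_contra! hlr
      have hjoin := adj_of_degree (A := core G h) (B := Finset.univ)
        (dA := (core G h).card - 1) (dB := r) (by omega) hG hnc hsat (by omega)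
        (fun u hu => (hdegC u hu).ge) fun v _ => hdeg v
      have : (Finset.univ : Finset V) ⊆ core G h := fun v _ =>
        mem_core_of_forall_adj hne fun u hu huv => hjoin u hu v (Finset.mem_univ _) huv
      have := Finset.card_le_card this
      omega
    obtain ⟨a, ha⟩ : ∃ a, a = k - (core G h).card := ⟨_, rfl⟩
    have hsub : core G h ⊆ core G a := subset_core fun u hu => by
      rw [hdegC u hu]
      omega
    -- With `l` the size of the clique, the degrees `l - 1` and `a + 1` add up to exactly `k`, so
    -- the larger core is joined to the clique and absorbed by it.
    have hcore : core G a = core G h := by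
      refine Finset.Subset.antisymm (fun v hv => ?_) hsub
      have hjoin := adj_of_degree (A := core G h) (B := core G a)
        (dA := (core G h).card - 1) (dB := a + 1) (by omega) hG hnc hsat (by omega)
        (fun u hu => (hdegC u hu).ge) fun v hv => lt_card_core hv
      exact mem_core_of_forall_adj hne fun u hu huv => hjoin u hu v hv huv
    refine ⟨a, by omega, .inl (by omega), ?_⟩
    have hka : k - a = (core G h).card := by omega
    -- Deletion stops at the clique itself, which has `k - a` vertices.
    have := card_bicliques_le_of_degenerate (G := G) (d := a) (c := k - a) (K := core G h) hs ht
      (fun W hW hWc => hcore ▸ exists_not_mem_core (hcore ▸ hW)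
        (fun h0 => by rw [h0, hcore] at hWc; omega))
      Finset.univ (by simp) (by omega)
    rwa [hcardV] at this

end Core

lemma TwoConnected.mono {V : Type*} [Fintype V] {G G' : SimpleGraph V} (hle : G ≤ G')
    (h : TwoConnected G) : TwoConnected G' :=
  ⟨h.1, h.2.1.mono hle, fun v => (h.2.2 v).mono fun _ _ hab => hle hab⟩

/-- A 2-connected graph with more copies of `K_{s,t}` than the extremal graphs has a long cycle. -/
lemma hasCycle_of_lt_numK {V : Type*} [Fintype V] (G : SimpleGraph V) [DecidableRel G.Adj]
    {s t k r : ℕ} (hs : 1 ≤ s) (ht : 1 ≤ t) (hk : 5 ≤ k) (hkn : k ≤ Fintype.card V)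
    (hG : TwoConnected G) (hr : r ≤ G.minDegree)
    (hN : max (g s t (Fintype.card V) k r) (g s t (Fintype.card V) k ((k - 1) / 2)) < numK s t G) :
    HasCycleOfLengthAtLeast G k := by
  classical
  by_contra hnc
  obtain ⟨G', hle, hnc', hsat⟩ := exists_saturated hnc
  have hdeg : ∀ v, r ≤ (Finset.univ.filter fun x => G'.Adj v x).card := by
    intro v
    refine (hr.trans (G.minDegree_le_degree v)).trans (Finset.card_le_card fun x hx => ?_)
    rw [SimpleGraph.mem_neighborFinset] at hx
    exact Finset.mem_filter.mpr ⟨Finset.mem_univ _, hle hx⟩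
  obtain ⟨a, hah, hra, hcard⟩ := exists_card_bicliques_le hs ht hk hkn (hG.mono hle).unseparable hnc'
    hsat hdeg
  have h1 := numK_mul G hs ht
  have h2 := Finset.card_le_card (bicliques_mono hle s t Finset.univ)
  have hgh := g_mul_eq_orderedG (t := t) (a := (k - 1) / 2) hs hkn (by omega)
  have hc : 0 < (if s = t then 2 else 1) := by split_ifs <;> omega
  obtain ⟨hNr, hNh⟩ := max_lt_iff.mp hN
  have hNh' := Nat.mul_lt_mul_of_pos_right hNh hc
  rcases hra with hra | rfl
  · have hconv := le_max_of_convex (f := orderedG s t (Fintype.card V) k)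
      (fun b _ hbh => orderedG_convex hs ht hkn (by omega)) hra hah
    have hgr := g_mul_eq_orderedG (t := t) (a := r) hs hkn (by omega)
    have hNr' := Nat.mul_lt_mul_of_pos_right hNr hc
    rw [hgr] at hNr'
    rw [hgh] at hNh'
    have := max_lt hNr' hNh'
    omega
  · omega

/-! ### The extremal graphs -/

section ExtremalGraph

variable {n k a : ℕ}

lemma H_adj {i j : Fin n} : (H n k a).Adj i j ↔ i ≠ j ∧
    (((i : ℕ) < k - a ∧ (j : ℕ) < k - a) ∨
      ((i : ℕ) < a ∧ k - a ≤ (j : ℕ)) ∨ ((j : ℕ) < a ∧ k - a ≤ (i : ℕ))) := Iff.rfl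

lemma H_adj_of_lt (hak : 2 * a < k) {i j : Fin n} (hi : (i : ℕ) < a) (hij : i ≠ j) :
    (H n k a).Adj i j := by
  rw [H_adj]
  exact ⟨hij, by omega⟩

lemma connected_of_hub {V : Type*} {G : SimpleGraph V} (u : V) (hu : ∀ v, u ≠ v → G.Adj u v) :
    G.Connected := by
  have hreach : ∀ v, G.Reachable u v := by
    intro v
    by_cases h : u = v
    · exact h ▸ .refl u
    · exact (hu v h).reachable
  exact { preconnected := fun v w => (hreach v).symm.trans (hreach w), nonempty := ⟨u⟩ }

/-- Vertices of `A` are adjacent to all others, and since `a ≥ 2` one of them survives any deletion.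
-/
lemma H_twoConnected (ha : 2 ≤ a) (hak : 2 * a < k) (hkn : k ≤ n) : TwoConnected (H n k a) := by
  refine ⟨by rw [Fintype.card_fin]; omega, ?_, fun v => ?_⟩
  · exact connected_of_hub ⟨0, by omega⟩ fun v hv => H_adj_of_lt hak (by simp; omega) hv
  · obtain ⟨u, hu, huv⟩ : ∃ u : Fin n, (u : ℕ) < a ∧ u ≠ v := by
      by_cases h : (v : ℕ) = 0
      · exact ⟨⟨1, by omega⟩, by simp; omega, fun h' => by simp [← h'] at h⟩
      · exact ⟨⟨0, by omega⟩, by simp; omega, fun h' => by simp [← h'] at h⟩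
    exact connected_of_hub ⟨u, huv⟩ fun w hw =>
      H_adj_of_lt hak hu fun h => hw (Subtype.ext h)

lemma le_minDegree_H {r : ℕ} (hra : r ≤ a) (hak : 2 * a < k) (hkn : k ≤ n) :
    r ≤ (H n k a).minDegree := by
  have : Nonempty (Fin n) := ⟨⟨0, by omega⟩⟩
  refine SimpleGraph.le_minDegree_of_forall_le_degree _ _ fun v => hra.trans ?_
  rw [← SimpleGraph.card_neighborFinset_eq_degree]
  by_cases hv : (v : ℕ) < k - a
  · have h1 : ((Finset.range (k - a)).erase v).card ≤ ((H n k a).neighborFinset v).card := by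
      refine Finset.card_le_card_of_injOn (fun i => if h : i < n then ⟨i, h⟩ else v) ?_ ?_
      · intro i hi
        have hi' : i < k - a ∧ i ≠ v := by simpa using hi
        have hin : i < n := by omega
        simp only [dif_pos hin, Finset.mem_coe, SimpleGraph.mem_neighborFinset, H_adj]
        exact ⟨fun h => hi'.2 (congrArg Fin.val h).symm, .inl ⟨hv, hi'.1⟩⟩
      · intro i hi j hj hij
        have hi' : i < k - a ∧ i ≠ v := by simpa using hi
        have hj' : j < k - a ∧ j ≠ v := by simpa using hj
        have hin : i < n := by omega
        have hjn : j < n := by omega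
        simpa [hin, hjn] using hij
    rw [Finset.card_erase_of_mem (by simpa using hv), Finset.card_range] at h1
    omega
  · have h1 : (Finset.range a).card ≤ ((H n k a).neighborFinset v).card := by
      refine Finset.card_le_card_of_injOn (fun i => if h : i < n then ⟨i, h⟩ else v) ?_ ?_
      · intro i hi
        have hi' : i < a := by simpa using hi
        have hin : i < n := by omega
        simp only [dif_pos hin, Finset.mem_coe, SimpleGraph.mem_neighborFinset]
        exact (H_adj_of_lt hak hi' fun h => hv (by rw [← h]; simp; omega)).symm
      · intro i hi j hj hij
        have hi' : i < a := by simpa using hi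
        have hj' : j < a := by simpa using hj
        have hin : i < n := by omega
        have hjn : j < n := by omega
        simpa [hin, hjn] using hij
    rwa [Finset.card_range] at h1

/-- The vertices of `H` with index less than `j`. -/
def below (n j : ℕ) : Finset (Fin n) := Finset.univ.filter fun i => (i : ℕ) < j

lemma mem_below {j : ℕ} {i : Fin n} : i ∈ below n j ↔ (i : ℕ) < j := by simp [below]

lemma card_below {j : ℕ} (hj : j ≤ n) : (below n j).card = j := by
  have h := Fin.card_filter_val_lt (n := n) (m := j)
  rwa [Nat.min_eq_right hj] at h

/-- The vertices of `B` are added in order to the clique `A ∪ C`. Each has neighbourhood `A`, whose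
vertices are dominating, so each adds exactly `loss`. -/
lemma card_bicliques_H {s t : ℕ} (hs : 1 ≤ s) (ht : 1 ≤ t) (hak : 2 * a < k) {j : ℕ}
    (hkj : k - a ≤ j) (hj : j ≤ n) :
    (bicliques (H n k a) s t (below n j)).card =
      ∑ i ∈ Finset.Ico (k - a) j, loss s t a i + cliqueCount s t (k - a) := by
  classical
  induction j, hkj using Nat.le_induction with
  | base =>
    rw [card_bicliques_eq s t ht, card_below hj, Finset.Ico_self, Finset.sum_empty, zero_add]
    intro u hu w hw huw
    exact ⟨huw, .inl ⟨mem_below.mp hu, mem_below.mp hw⟩⟩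
  | succ j hkj ih =>
    have hnotMem : (⟨j, hj⟩ : Fin n) ∉ below n j := by simp [mem_below]
    have hins : below n (j + 1) = insert ⟨j, hj⟩ (below n j) := by
      ext i
      rw [Finset.mem_insert, mem_below, mem_below, Fin.ext_iff]
      simp only
      omega
    have hfilter : (below n j).filter (fun w => (H n k a).Adj ⟨j, hj⟩ w) = below n a := by
      ext i
      rw [Finset.mem_filter, mem_below, mem_below, H_adj, Ne, Fin.ext_iff]
      simp only
      omega
    rw [hins, card_bicliques_insert_eq (d := a) hnotMem hs ht, ih (by omega), card_below (by omega),
      Finset.sum_Ico_succ_top hkj]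
    · omega
    · have hd := card_below (n := n) (j := a) (by omega)
      rw [← hfilter] at hd
      convert hd
    · intro u hu huv w _ huw
      have : u ∈ below n a := by
        rw [← hfilter]
        exact Finset.mem_filter.mpr ⟨hu, huv⟩
      exact H_adj_of_lt hak (mem_below.mp this) huw

lemma numK_H {s t : ℕ} (hs : 1 ≤ s) (ht : 1 ≤ t) (hak : 2 * a < k) (hkn : k ≤ n) :
    numK s t (H n k a) = g s t n k a := by
  have h1 := numK_mul (H n k a) hs ht
  have h2 := g_mul_eq_orderedG (t := t) hs hkn (by omega : a ≤ k)
  have h3 := card_bicliques_H hs ht hak (by omega : k - a ≤ n) le_rfl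
  have h4 : below n n = Finset.univ := by
    ext i
    simp [mem_below]
  rw [h4, h1.symm, ← orderedG, ← h2] at h3
  refine Nat.eq_of_mul_eq_mul_right ?_ h3
  split_ifs <;> omega

lemma not_hasCycle_H (ha : 1 ≤ a) (hak : 2 * a < k) :
    ¬ HasCycleOfLengthAtLeast (H n k a) k := by
  rintro ⟨v, p, hp, hk⟩
  let x : ℕ → Fin n := p.getVert
  -- The cyclic successor of a position; the closing vertex is counted at index `0` only.
  let next : ℕ → ℕ := fun i => if i + 1 < p.length then i + 1 else 0
  have hL : 0 < p.length := by omega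
  have hnext : ∀ i < p.length, next i < p.length := by
    intro i hi
    simp only [next]
    split_ifs <;> omega
  have hadj : ∀ i < p.length, (H n k a).Adj (x i) (x (next i)) := by
    intro i hi
    have h := p.adj_getVert_succ hi
    simp only [next, x]
    split_ifs with h1
    · exact h
    · rw [show i + 1 = p.length by omega, p.getVert_length] at h
      rwa [p.getVert_zero]
  have hinj : ∀ i < p.length, ∀ j < p.length, x i = x j → i = j := fun i hi j hj hij =>
    hp.getVert_injOn' (by rw [Set.mem_ofPred_eq]; omega) (by rw [Set.mem_ofPred_eq]; omega) hij
  have hnextinj : ∀ i < p.length, ∀ j < p.length, next i = next j → i = j := by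
    intro i hi j hj hij
    simp only [next] at hij
    split_ifs at hij <;> omega
  let A := (Finset.range p.length).filter fun i => (x i : ℕ) < a
  let B := (Finset.range p.length).filter fun i => k - a ≤ (x i : ℕ)
  have hA : ∀ i, i ∈ A ↔ i < p.length ∧ (x i : ℕ) < a := fun i => by simp [A]
  have hB : ∀ i, i ∈ B ↔ i < p.length ∧ k - a ≤ (x i : ℕ) := fun i => by simp [B]
  have hAcard : A.card ≤ a := by
    rw [← Finset.card_range a]
    refine Finset.card_le_card_of_injOn (fun i => (x i : ℕ)) ?_ ?_
    · intro i hi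
      simpa using ((hA i).mp hi).2
    · intro i hi j hj hij
      exact hinj i ((hA i).mp hi).1 j ((hA j).mp hj).1 (Fin.ext hij)
  -- Only `k - a` vertices lie outside `B`, and the cycle has at least `k`.
  have hBcard : a ≤ B.card := by
    have h1 : ((Finset.range p.length) \ B).card ≤ k - a := by
      rw [← Finset.card_range (k - a)]
      refine Finset.card_le_card_of_injOn (fun i => (x i : ℕ)) ?_ ?_
      · intro i hi
        have hi' := Finset.mem_sdiff.mp hi
        rw [hB, Finset.mem_range] at hi'
        simp only [Finset.coe_range, Set.mem_Iio]
        by_contra hlt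
        exact hi'.2 ⟨hi'.1, by omega⟩
      · intro i hi j hj hij
        have hi' := (Finset.mem_sdiff.mp hi).1
        have hj' := (Finset.mem_sdiff.mp hj).1
        rw [Finset.mem_range] at hi' hj'
        exact hinj i hi' j hj' (Fin.ext hij)
    have h2 : B ⊆ Finset.range p.length := Finset.filter_subset _ _
    rw [Finset.card_sdiff_of_subset h2, Finset.card_range] at h1
    omega
  have himg : B.image next ⊆ A := by
    intro j hj
    obtain ⟨i, hi, rfl⟩ := Finset.mem_image.mp hj
    obtain ⟨hi1, hi2⟩ := (hB i).mp hi
    have h := hadj i hi1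
    rw [H_adj] at h
    exact (hA _).mpr ⟨hnext i hi1, by omega⟩
  have himgcard : (B.image next).card = B.card :=
    Finset.card_image_of_injOn fun i hi j hj hij =>
      hnextinj i ((hB i).mp hi).1 j ((hB j).mp hj).1 hij
  have heq : B.image next = A := Finset.eq_of_subset_of_card_le himg (by omega)
  have hAB : A.card = B.card := by rw [← heq, himgcard]
  -- Successors of `B` fill `A`, so vertices of `A` are entered only from `B`. As `C` and `B` are
  -- not adjacent, the successor of a vertex of `C` is again in `C`.
  have hprev : ∀ i < p.length, (x (next i) : ℕ) < a → k - a ≤ (x i : ℕ) := by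
    intro i hi h
    have hmem : next i ∈ A := (hA _).mpr ⟨hnext i hi, h⟩
    rw [← heq, Finset.mem_image] at hmem
    obtain ⟨j, hj, hij⟩ := hmem
    have hjB := (hB j).mp hj
    rw [← hnextinj j hjB.1 i hi hij]
    exact hjB.2
  have hC : ∀ i < p.length, a ≤ (x i : ℕ) ∧ (x i : ℕ) < k - a →
      a ≤ (x (next i) : ℕ) ∧ (x (next i) : ℕ) < k - a := by
    intro i hi hx
    have h1 := hprev i hi
    have h2 := hadj i hi
    rw [H_adj] at h2
    omega
  -- `A` and `B` together account for at most `2 * a < k` positions. From `c` the cycle stays in `C`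
  -- to its end, and then from index `0` on.
  obtain ⟨c, hc, hcx⟩ : ∃ c < p.length, a ≤ (x c : ℕ) ∧ (x c : ℕ) < k - a := by
    by_contra! hno
    have hcover : Finset.range p.length ⊆ A ∪ B := by
      intro i hi
      rw [Finset.mem_range] at hi
      rw [Finset.mem_union, hA, hB]
      have := hno i hi
      omega
    have h1 := (Finset.card_le_card hcover).trans (Finset.card_union_le _ _)
    rw [Finset.card_range] at h1
    omega
  have hup : ∀ i, c ≤ i → i < p.length → a ≤ (x i : ℕ) ∧ (x i : ℕ) < k - a := by
    intro i hi
    induction i, hi using Nat.le_induction with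
    | base => exact fun _ => hcx
    | succ i hi ih =>
      intro hlt
      have := hC i (by omega) (ih (by omega))
      simpa only [next, if_pos hlt] using this
  have hzero : a ≤ (x 0 : ℕ) ∧ (x 0 : ℕ) < k - a := by
    have := hC (p.length - 1) (by omega) (hup _ (by omega) (by omega))
    simpa only [next, if_neg (by omega : ¬ p.length - 1 + 1 < p.length)] using this
  have hall : ∀ i < p.length, a ≤ (x i : ℕ) ∧ (x i : ℕ) < k - a := by
    intro i
    induction i with
    | zero => exact fun _ => hzero
    | succ i ih =>
      intro hlt
      have := hC i (by omega) (ih (by omega))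
      simpa only [next, if_pos hlt] using this
  obtain ⟨i, hi⟩ : B.Nonempty := Finset.card_pos.mp (by omega)
  have h1 := (hB i).mp hi
  have h2 := hall i h1.1
  omega

lemma isSharp {s t r : ℕ} (hs : 1 ≤ s) (ht : 1 ≤ t) (hr : 2 ≤ r) (hra : r ≤ a) (hak : 2 * a < k)
    (hkn : k ≤ n) : IsSharp s t n k r a :=
  ⟨H_twoConnected (hr.trans hra) hak hkn, le_minDegree_H hra hak hkn,
    not_hasCycle_H (by omega) hak, numK_H hs ht hak hkn⟩

end ExtremalGraph

end LongCycle

theorem theorem2p4 (s t n k r : ℕ) (hs : 1 ≤ s) (ht : 1 ≤ t)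
    (hr : 2 ≤ r) (hk : 5 ≤ k) (hkn : k ≤ n) :
    (∀ {V : Type*} [Fintype V] (G : SimpleGraph V) [DecidableRel G.Adj],
      Fintype.card V = n → LongCycle.TwoConnected G → r ≤ G.minDegree →
      max (LongCycle.g s t n k r) (LongCycle.g s t n k ((k - 1) / 2)) < LongCycle.numK s t G →
      LongCycle.HasCycleOfLengthAtLeast G k) ∧
    (2 * r < k →
      LongCycle.IsSharp s t n k r r ∧ LongCycle.IsSharp s t n k r ((k - 1) / 2)) := by
  refine ⟨fun G _ hV hG hdeg hN => ?_, fun hrk => ⟨?_, ?_⟩⟩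
  · subst hV
    exact LongCycle.hasCycle_of_lt_numK G hs ht hk hkn hG hdeg hN
  · exact LongCycle.isSharp hs ht hr le_rfl hrk hkn
  · exact LongCycle.isSharp hs ht hr (by omega) (by omega) hkn
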